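/- **Setting.** Let $H$ be a complex Hilbert space and $M\subseteq B(H)$ a von Neumann algebra with a faithful normal finite trace $\tau$; let $P(M)$ be the set of projections of $M$. Let $S(M,\tau)$ be the $*$-algebra of $\tau$-measurable operators: closed operators $x$ affiliated with $M$ such that for each $\varepsilon>0$ there is $p\in P(M)$ with $p(H)\subseteq \mathcal D(x)$ and $\tau(\mathbf 1-p)<\varepsilon$, with strong addition and strong multiplication (closures of the algebraic sum and product). A *Young function* is a function $\phi(t)=\int_0^t v(s)\,ds$, $t\ge 0$, where $v:[0,\infty)\to\mathbb R$ is right continuous, nondecreasing on $(0,\infty)$, $v(0)=0$, $v(s)>0$ for $s>0$ and $v(s)\to\infty$ as $s\to\infty$. Write $\phi_1\prec\phi_2$ if there are $c,T\ge 0$ with $\phi_1(t)\le\phi_2(ct)$ for all $t\ge T$. A nonempty set $\Lambda$ of Young functions is a *quadratic family* if for all $\phi_1,\phi_2\in\Lambda$ there is $\psi\in\Lambda$ with $\phi_1\prec\psi$ and $\phi_2\prec\psi$, and for every $\phi\in\Lambda$ there are $\psi\in\Lambda$, $c>0$ and $T\ge 0$ with $\phi(t^2)\le\psi(ct)$ for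 all $t\ge T$. Put $$K_\phi=\{x\in S(M,\tau):\tau(\phi(|x|))\le 1\},\qquad L_\phi(M,\tau)=\bigcup_{n=1}^\infty nK_\phi,\qquad L^\Lambda(M,\tau)=\bigcap_{\phi\in\Lambda}L_\phi(M,\tau).$$ For a quadratic family $\Lambda$, $L^\Lambda(M,\tau)$ is a subalgebra of $S(M,\tau)$. An *additive derivation* on it is a map $D:L^\Lambda(M,\tau)\to L^\Lambda(M,\tau)$ with $D(x+y)=D(x)+D(y)$ and $D(xy)=D(x)y+xD(y)$ for all $x,y$. **Corollary 3.1.** Suppose that $M$ is commutative and that the Boolean algebra $P(M)$ is continuous, i.e. atomless: for every nonzero $p\in P(M)$ there is $q\in P(M)$ with $0\neq q\le p$ and $q\neq p$. Then, for every quadratic family $\Lambda$ of Young functions, every additive derivation on $L^\Lambda(M,\tau)$ is zero. -/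

import Mathlib

noncomputable section

namespace GenArens

open Filter Set
open scoped ENNReal

variable {H : Type*} [NormedAddCommGroup H] [InnerProductSpace ℂ H] [CompleteSpace H]

/-! ### Von Neumann algebras, projections and traces -/

/-- The von Neumann algebra `M` is commutative. -/
def IsCommutative (M : VonNeumannAlgebra H) : Prop :=
  ∀ a ∈ M, ∀ b ∈ M, a * b = b * a

/-- `P(M)`: the orthogonal projections belonging to `M`, ordered by the usual (Loewner) order. -/
def projections (M : VonNeumannAlgebra H) : Set (H →L[ℂ] H) :=
  {p | p ∈ M ∧ IsStarProjection p}

/-- `P(M)` is continuous, i.e. atomless: every nonzero projection of `M` dominates a projection of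
`M` that is different from it and nonzero. -/
def HasContinuousProjections (M : VonNeumannAlgebra H) : Prop :=
  ∀ p ∈ projections M, p ≠ 0 → ∃ q ∈ projections M, q ≠ 0 ∧ q ≤ p ∧ q ≠ p

/-- A faithful normal finite trace on `M`: an everywhere defined positive linear functional which
is tracial, faithful, and preserves suprema of (bounded) increasing nets of positive elements. -/
structure IsFaithfulNormalFiniteTrace (M : VonNeumannAlgebra H)
    (τ : M.toStarSubalgebra →ₗ[ℂ] ℂ) : Prop where
  nonneg : ∀ a : M.toStarSubalgebra, 0 ≤ (a : H →L[ℂ] H) → 0 ≤ (τ a).re ∧ (τ a).im = 0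
  tracial : ∀ a b : M.toStarSubalgebra, τ (a * b) = τ (b * a)
  faithful : ∀ a : M.toStarSubalgebra, 0 ≤ (a : H →L[ℂ] H) → τ a = 0 → a = 0
  normal : ∀ (S : Set M.toStarSubalgebra) (a : M.toStarSubalgebra),
    S.Nonempty → (∀ s ∈ S, 0 ≤ (s : H →L[ℂ] H)) →
    DirectedOn (fun s t : M.toStarSubalgebra => (s : H →L[ℂ] H) ≤ (t : H →L[ℂ] H)) S →
    (∀ s ∈ S, (s : H →L[ℂ] H) ≤ (a : H →L[ℂ] H)) →
    (∀ b : M.toStarSubalgebra, (∀ s ∈ S, (s : H →L[ℂ] H) ≤ (b : H →L[ℂ] H)) →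
      (a : H →L[ℂ] H) ≤ (b : H →L[ℂ] H)) →
    IsLUB ((fun s => (τ s).re) '' S) (τ a).re

open Classical in
/-- The value `τ(a) ∈ [0,∞]` for a positive bounded operator `a` that belongs to `M`
(by convention `∞` for an operator outside `M`). -/
def posTrace (M : VonNeumannAlgebra H) (τ : M.toStarSubalgebra →ₗ[ℂ] ℂ) (a : H →L[ℂ] H) : ℝ≥0∞ :=
  if h : a ∈ M.toStarSubalgebra then ENNReal.ofReal (τ ⟨a, h⟩).re else ∞

/-! ### Unbounded operators -/

/-- The composition `x ∘ y` of two unbounded operators on its natural domain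
`{ξ ∈ D(y) : y ξ ∈ D(x)}`. -/
def opComp (x y : H →ₗ.[ℂ] H) : H →ₗ.[ℂ] H :=
  x.comp (y.domRestrict ((x.domain.comap y.toFun).map y.domain.subtype)) (by
    rintro ⟨ξ, hξ, hξ'⟩
    obtain ⟨η, hη, rfl⟩ := hξ
    exact hη)

/-- The strong sum: the closure of the algebraic sum (with domain `D(x) ∩ D(y)`). -/
def strongAdd (x y : H →ₗ.[ℂ] H) : H →ₗ.[ℂ] H := (x + y).closure

/-- The strong product: the closure of the composition. -/
def strongMul (x y : H →ₗ.[ℂ] H) : H →ₗ.[ℂ] H := (opComp x y).closure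

/-- The operator `x` is affiliated with `M`: every unitary `u` of the commutant `M'` maps `D(x)`
into itself and satisfies `u (x ξ) = x (u ξ)` for `ξ ∈ D(x)`. -/
def IsAffiliated (M : VonNeumannAlgebra H) (x : H →ₗ.[ℂ] H) : Prop :=
  ∀ u ∈ M.commutant, u ∈ unitary (H →L[ℂ] H) →
    ∀ ξ : x.domain, ∃ h : u (ξ : H) ∈ x.domain, u (x ξ) = x ⟨u (ξ : H), h⟩

/-- `S(M, τ)`: the `τ`-measurable operators, i.e. the closed operators `x` affiliated with `M` such
that for every `ε > 0` there is a projection `p ∈ M` with `p(H) ⊆ D(x)` and `τ(1 - p) < ε`. -/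
def measurableOps (M : VonNeumannAlgebra H) (τ : M.toStarSubalgebra →ₗ[ℂ] ℂ) :
    Set (H →ₗ.[ℂ] H) :=
  {x | x.IsClosed ∧ IsAffiliated M x ∧
    ∀ ε : ℝ≥0∞, 0 < ε → ∃ p ∈ projections M,
      (∀ ξ : H, p ξ ∈ x.domain) ∧ posTrace M τ (1 - p) < ε}

open Classical in
/-- The bounded operator `(1 + a)⁻¹`, for a positive self-adjoint (possibly unbounded) operator `a`:
the everywhere defined operator `r` such that `r ξ = η` if and only if `η ∈ D(a)` and
`η + a η = ξ`. -/
def onePlusInv (a : H →ₗ.[ℂ] H) : H →L[ℂ] H :=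
  if h : ∃ r : H →L[ℂ] H, ∀ ξ η : H, r ξ = η ↔ (η, ξ - η) ∈ a.graph then h.choose else 0

/-- The bounded operator `f(|x|)`, where `|x| = (x* x)^{1/2}`, for a closed densely defined operator
`x` and a continuous function `f` on `[0, ∞)` with limit `l` at infinity. It is given by the
continuous functional calculus of the bounded operator `r = (1 + x* x)⁻¹ = (1 + |x|²)⁻¹`, whose
spectrum is contained in `[0, 1]`: since `|x| = (r⁻¹ - 1)^{1/2}`, we have `f(|x|) = F(r)` with
`F(s) = f((s⁻¹ - 1)^{1/2})` for `0 < s ≤ 1` and `F(0) = l`. -/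
def absCalculus (f : ℝ → ℝ) (l : ℝ) (x : H →ₗ.[ℂ] H) : H →L[ℂ] H :=
  cfc (fun s : ℝ => if s = 0 then l else f (Real.sqrt (s⁻¹ - 1)))
    (onePlusInv (opComp x.adjoint x))

/-- `τ(φ(|x|)) ∈ [0, ∞]` for a continuous function `φ ≥ 0` on `[0, ∞)` with `φ(t) → ∞` as `t → ∞`.
The trace of the positive (possibly unbounded) operator `b = φ(|x|)` is the supremum of the traces
of its bounded truncations `min(b, n) = min(φ, n)(|x|)`. -/
def traceOfAbs (M : VonNeumannAlgebra H) (τ : M.toStarSubalgebra →ₗ[ℂ] ℂ) (φ : ℝ → ℝ)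
    (x : H →ₗ.[ℂ] H) : ℝ≥0∞ :=
  ⨆ n : ℕ, posTrace M τ (absCalculus (fun t => min (φ t) n) n x)

/-! ### Young functions and generalized Arens algebras -/

/-- `φ` is a Young function: `φ(t) = ∫₀ᵗ v(s) ds` for `t ≥ 0`, where `v : [0, ∞) → ℝ` is right
continuous, nondecreasing, with `v(0) = 0`, `v(s) > 0` for `s > 0`, and `v(s) → ∞` as `s → ∞`.
Only the values of `φ` and `v` on `[0, ∞)` matter. -/
def IsYoungFunction (φ : ℝ → ℝ) : Prop :=
  ∃ v : ℝ → ℝ, v 0 = 0 ∧ (∀ s, 0 < s → 0 < v s) ∧ Tendsto v atTop atTop ∧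
    (∀ s, 0 ≤ s → ContinuousWithinAt v (Ici s) s) ∧ MonotoneOn v (Ioi 0) ∧
    ∀ t, 0 ≤ t → φ t = ∫ s in (0 : ℝ)..t, v s

/-- `φ₁ ≺ φ₂`: there are constants `c, T ≥ 0` with `φ₁(t) ≤ φ₂(c t)` for all `t ≥ T`. -/
def YoungPrec (φ₁ φ₂ : ℝ → ℝ) : Prop :=
  ∃ c T : ℝ, 0 ≤ c ∧ 0 ≤ T ∧ ∀ t, T ≤ t → φ₁ t ≤ φ₂ (c * t)

/-- A quadratic (generating, nonempty) family of Young functions. -/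
structure IsQuadraticFamily (Λ : Set (ℝ → ℝ)) : Prop where
  nonempty : Λ.Nonempty
  young : ∀ φ ∈ Λ, IsYoungFunction φ
  generating : ∀ φ₁ ∈ Λ, ∀ φ₂ ∈ Λ, ∃ ψ ∈ Λ, YoungPrec φ₁ ψ ∧ YoungPrec φ₂ ψ
  quadratic : ∀ φ ∈ Λ, ∃ ψ ∈ Λ, ∃ c T : ℝ, 0 < c ∧ 0 ≤ T ∧ ∀ t, T ≤ t → φ (t ^ 2) ≤ ψ (c * t)

/-- `K_φ = {x ∈ S(M, τ) : τ(φ(|x|)) ≤ 1}`. -/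
def youngBall (M : VonNeumannAlgebra H) (τ : M.toStarSubalgebra →ₗ[ℂ] ℂ) (φ : ℝ → ℝ) :
    Set (H →ₗ.[ℂ] H) :=
  {x | x ∈ measurableOps M τ ∧ traceOfAbs M τ φ x ≤ 1}

/-- `L_φ(M, τ) = ⋃_{n ≥ 1} n K_φ`. -/
def orliczSpace (M : VonNeumannAlgebra H) (τ : M.toStarSubalgebra →ₗ[ℂ] ℂ) (φ : ℝ → ℝ) :
    Set (H →ₗ.[ℂ] H) :=
  {x | ∃ n : ℕ, 1 ≤ n ∧ ∃ y ∈ youngBall M τ φ, x = (n : ℂ) • y}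

/-- The generalized Arens algebra `L^Λ(M, τ) = ⋂_{φ ∈ Λ} L_φ(M, τ)`. -/
def arensAlgebra (M : VonNeumannAlgebra H) (τ : M.toStarSubalgebra →ₗ[ℂ] ℂ)
    (Λ : Set (ℝ → ℝ)) : Set (H →ₗ.[ℂ] H) :=
  {x | ∀ φ ∈ Λ, x ∈ orliczSpace M τ φ}

/-- `D : A → A` is an additive derivation of an algebra `A` of closed operators, whose operations
are strong addition and strong multiplication: `D(x + y) = D(x) + D(y)` and
`D(x y) = D(x) y + x D(y)`. -/
structure IsAdditiveDerivation (A : Set (H →ₗ.[ℂ] H)) (D : A → A) : Prop where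
  map_add : ∀ x y z : A, (z : H →ₗ.[ℂ] H) = strongAdd x y →
    (D z : H →ₗ.[ℂ] H) = strongAdd (D x) (D y)
  leibniz : ∀ x y z : A, (z : H →ₗ.[ℂ] H) = strongMul x y →
    (D z : H →ₗ.[ℂ] H) = strongAdd (strongMul (D x) y) (strongMul x (D y))

end GenArens

end

/-! Restrict `D` to `M`, getting an additive derivation `d` into measurable operators. From `e² =
e`, commutativity gives `d e = 0` for each projection `e`, so `d (a * e) = d a · e`: derivations are
local. Only dyadic scalars are used at first, since `d` is not assumed linear.

The engine is the map `t ↦ 2t mod 1`. If `0 ≤ a ≤ 1` and `e` is a spectral projection cutting at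
`1/2`, then `2a - e` again lies between `0` and `1`, while its derivative is `2 d a`. Iterating
(`exists_map_eq_two_pow_smul`), one unit ball contains elements with derivative `2^k d a` for every
`k`.

If `d a ≠ 0`, then `|d a| ≥ δ > 0` on some nonzero projection, below which atomlessness yields
orthogonal nonzero projections `q n`. Gluing elements with derivative `2^(k n) d a` along the `q n`,
damped by `2^(-n)`, gives a single `y` in `M` with `|d y| ≥ 2^(k n - n) δ` on `q n`. With `k n`
growing fast enough, Chebyshev's inequality (`mul_trace_le_one`) excludes `d y ∈ n K_φ` for every
`n`, a contradiction. So `d` vanishes on `[0, 1]`, then on self-adjoint elements by dyadic scaling,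
then on `M` since `d i = 0`. An unbounded `x` is cut down by projections `p` with `x p` in `M`. -/

noncomputable section

namespace GenArens

open Filter Set
open scoped ENNReal

/-! ### Partial operators through their graphs. -/

section PartialOperators

variable {H : Type*} [NormedAddCommGroup H] [InnerProductSpace ℂ H]

/-- A bounded operator, regarded as an everywhere defined partial operator. -/
def ofBounded (a : H →L[ℂ] H) : H →ₗ.[ℂ] H := (a : H →ₗ[ℂ] H).toPMap ⊤

theorem mem_graph_ofBounded {a : H →L[ℂ] H} {ξ η : H} :
    (ξ, η) ∈ (ofBounded a).graph ↔ a ξ = η := by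
  simp [LinearPMap.mem_graph_iff, ofBounded]

theorem ext_graph {x y : H →ₗ.[ℂ] H}
    (h : ∀ ξ η, (ξ, η) ∈ x.graph ↔ (ξ, η) ∈ y.graph) : x = y :=
  LinearPMap.eq_of_eq_graph (Submodule.ext fun ⟨ξ, η⟩ => h ξ η)

theorem graph_unique {x : H →ₗ.[ℂ] H} {ξ η ζ : H} (h : (ξ, η) ∈ x.graph)
    (h' : (ξ, ζ) ∈ x.graph) : η = ζ :=
  x.mem_graph_snd_inj h h' rfl

theorem mem_graph_smul {x : H →ₗ.[ℂ] H} {c : ℂ} {ξ η : H} :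
    (ξ, η) ∈ (c • x).graph ↔ ∃ ζ, (ξ, ζ) ∈ x.graph ∧ c • ζ = η := by
  simp [LinearPMap.smul_graph, Prod.ext_iff, -LinearPMap.mem_graph_iff]

theorem mem_graph_add {x y : H →ₗ.[ℂ] H} {ξ η : H} :
    (ξ, η) ∈ (x + y).graph ↔ ∃ η₁ η₂, (ξ, η₁) ∈ x.graph ∧ (ξ, η₂) ∈ y.graph ∧ η₁ + η₂ = η := by
  constructor
  · intro h
    obtain ⟨⟨ζ, h1, h2⟩, rfl, rfl⟩ := (LinearPMap.mem_graph_iff _).1 h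
    exact ⟨_, _, x.mem_graph ⟨ζ, h1⟩, y.mem_graph ⟨ζ, h2⟩, rfl⟩
  · rintro ⟨η₁, η₂, h1, h2, rfl⟩
    obtain ⟨⟨ζ, hζ⟩, rfl, rfl⟩ := (LinearPMap.mem_graph_iff _).1 h1
    obtain ⟨⟨ζ', hζ'⟩, h3, rfl⟩ := (LinearPMap.mem_graph_iff _).1 h2
    obtain rfl : ζ' = ζ := h3
    exact (x + y).mem_graph ⟨ζ', hζ, hζ'⟩

theorem mem_graph_opComp {x y : H →ₗ.[ℂ] H} {ξ η : H} :
    (ξ, η) ∈ (opComp x y).graph ↔ ∃ ζ, (ξ, ζ) ∈ y.graph ∧ (ζ, η) ∈ x.graph := by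
  constructor
  · intro h
    obtain ⟨⟨ζ, h1⟩, rfl, rfl⟩ := (LinearPMap.mem_graph_iff _).1 h
    have h3 := h1.2
    obtain ⟨ω, h2, hω⟩ := h1.1
    obtain rfl : ω = ⟨ζ, h3⟩ := Subtype.ext hω
    exact ⟨_, y.mem_graph ⟨ζ, h3⟩, x.mem_graph ⟨_, h2⟩⟩
  · rintro ⟨ζ, h1, h2⟩
    obtain ⟨⟨ξ', hξ⟩, rfl, rfl⟩ := (LinearPMap.mem_graph_iff _).1 h1
    obtain ⟨⟨ζ', hζ⟩, h3, rfl⟩ := (LinearPMap.mem_graph_iff _).1 h2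
    have h3 : ζ' = y ⟨ξ', hξ⟩ := h3
    subst h3
    have hm : ξ' ∈ (opComp x y).domain := ⟨⟨⟨ξ', hξ⟩, hζ, rfl⟩, hξ⟩
    exact (opComp x y).mem_graph ⟨ξ', hm⟩

theorem isClosed_iff {x : H →ₗ.[ℂ] H} : x.IsClosed ↔ IsClosed (x.graph : Set (H × H)) := Iff.rfl

theorem closure_eq_of_isClosed {x : H →ₗ.[ℂ] H} (hx : x.IsClosed) : x.closure = x := by
  apply LinearPMap.eq_of_eq_graph
  rw [← hx.isClosable.graph_closure_eq_closure_graph]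
  exact IsClosed.submodule_topologicalClosure_eq hx

theorem isClosed_ofBounded (a : H →L[ℂ] H) : (ofBounded a).IsClosed := by
  have : ((ofBounded a).graph : Set (H × H)) = {v | a v.1 = v.2} := by
    ext ⟨ξ, η⟩; exact mem_graph_ofBounded
  rw [isClosed_iff, this]
  exact isClosed_eq (by fun_prop) (by fun_prop)

/-- The graph is the preimage of a closed graph under `(ξ, η) ↦ (a ξ, η)`. Hence the closure in a
strong product does nothing when the right factor is bounded. -/
theorem isClosed_opComp_ofBounded {x : H →ₗ.[ℂ] H} (hx : x.IsClosed) (a : H →L[ℂ] H) :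
    (opComp x (ofBounded a)).IsClosed := by
  have : ((opComp x (ofBounded a)).graph : Set (H × H)) =
      (fun v : H × H => (a v.1, v.2)) ⁻¹' x.graph := by
    ext ⟨ξ, η⟩
    simp [mem_graph_opComp, mem_graph_ofBounded, -LinearPMap.mem_graph_iff]
  rw [isClosed_iff, this]
  exact IsClosed.preimage (by fun_prop) hx

theorem isClosed_smul {x : H →ₗ.[ℂ] H} (hx : x.IsClosed) {c : ℂ} (hc : c ≠ 0) :
    (c • x).IsClosed := by
  have : ((c • x).graph : Set (H × H)) = (fun v : H × H => (v.1, c⁻¹ • v.2)) ⁻¹' x.graph := by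
    ext ⟨ξ, η⟩
    simp only [SetLike.mem_coe, mem_graph_smul, mem_preimage]
    constructor
    · rintro ⟨ζ, h, rfl⟩
      rwa [inv_smul_smul₀ hc]
    · intro h
      exact ⟨_, h, smul_inv_smul₀ hc _⟩
  rw [isClosed_iff, this]
  exact IsClosed.preimage (by fun_prop) hx

theorem ofBounded_zero : ofBounded (0 : H →L[ℂ] H) = 0 := by
  apply ext_graph
  intro ξ η
  rw [mem_graph_ofBounded, LinearPMap.mem_graph_iff]
  simp

/-- No closability is needed: the closure of a non-closable operator is by default the operator
itself. This inclusion is enough to read operator identities at single vectors. -/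
theorem mem_graph_strongAdd {x y : H →ₗ.[ℂ] H} {ξ η ζ : H} (hx : (ξ, η) ∈ x.graph)
    (hy : (ξ, ζ) ∈ y.graph) : (ξ, η + ζ) ∈ (strongAdd x y).graph :=
  LinearPMap.le_graph_of_le (x + y).le_closure (mem_graph_add.2 ⟨_, _, hx, hy, rfl⟩)

theorem mem_graph_strongMul {x y : H →ₗ.[ℂ] H} {ξ η ζ : H} (hy : (ξ, η) ∈ y.graph)
    (hx : (η, ζ) ∈ x.graph) : (ξ, ζ) ∈ (strongMul x y).graph :=
  LinearPMap.le_graph_of_le (opComp x y).le_closure (mem_graph_opComp.2 ⟨_, hy, hx⟩)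

theorem strongAdd_zero {x : H →ₗ.[ℂ] H} (hx : x.IsClosed) : strongAdd x 0 = x := by
  rw [strongAdd, add_zero, closure_eq_of_isClosed hx]

theorem zero_strongAdd {x : H →ₗ.[ℂ] H} (hx : x.IsClosed) : strongAdd 0 x = x := by
  rw [strongAdd, zero_add, closure_eq_of_isClosed hx]

theorem strongAdd_self {x : H →ₗ.[ℂ] H} (hx : x.IsClosed) : strongAdd x x = (2 : ℂ) • x := by
  have : x + x = (2 : ℂ) • x := by
    apply ext_graph
    intro ξ η
    rw [mem_graph_add, mem_graph_smul]
    constructor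
    · rintro ⟨η₁, η₂, h1, h2, rfl⟩
      obtain rfl := graph_unique h1 h2
      exact ⟨_, h1, two_smul _ _⟩
    · rintro ⟨ζ, h, rfl⟩
      exact ⟨_, _, h, h, (two_smul _ _).symm⟩
  rw [strongAdd, this, closure_eq_of_isClosed (isClosed_smul hx two_ne_zero)]

theorem strongMul_ofBounded {x : H →ₗ.[ℂ] H} (hx : x.IsClosed) (a : H →L[ℂ] H) :
    strongMul x (ofBounded a) = opComp x (ofBounded a) :=
  closure_eq_of_isClosed (isClosed_opComp_ofBounded hx a)

theorem ofBounded_add (a b : H →L[ℂ] H) :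
    strongAdd (ofBounded a) (ofBounded b) = ofBounded (a + b) := by
  have : ofBounded a + ofBounded b = ofBounded (a + b) := by
    apply ext_graph
    intro ξ η
    simp [mem_graph_add, mem_graph_ofBounded, -LinearPMap.mem_graph_iff]
  rw [strongAdd, this, closure_eq_of_isClosed (isClosed_ofBounded _)]

theorem opComp_ofBounded_ofBounded (a b : H →L[ℂ] H) :
    opComp (ofBounded a) (ofBounded b) = ofBounded (a * b) := by
  apply ext_graph
  intro ξ η
  simp [mem_graph_opComp, mem_graph_ofBounded, -LinearPMap.mem_graph_iff]

theorem ofBounded_mul (a b : H →L[ℂ] H) :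
    strongMul (ofBounded a) (ofBounded b) = ofBounded (a * b) := by
  rw [strongMul_ofBounded (isClosed_ofBounded _), opComp_ofBounded_ofBounded]

theorem strongMul_zero {x : H →ₗ.[ℂ] H} (hx : x.IsClosed) : strongMul x 0 = 0 := by
  rw [← ofBounded_zero, strongMul_ofBounded hx]
  apply ext_graph
  intro ξ η
  simp only [mem_graph_opComp, mem_graph_ofBounded, zero_apply]
  constructor
  · rintro ⟨ζ, rfl, h⟩
    exact graph_unique x.graph.zero_mem h
  · rintro rfl
    exact ⟨0, rfl, x.graph.zero_mem⟩

theorem zero_strongMul_ofBounded (a : H →L[ℂ] H) : strongMul 0 (ofBounded a) = 0 := by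
  rw [← ofBounded_zero, ofBounded_mul, zero_mul]

theorem smul_ofBounded (c : ℂ) (a : H →L[ℂ] H) : c • ofBounded a = ofBounded (c • a) := by
  apply ext_graph
  intro ξ η
  simp [mem_graph_smul, mem_graph_ofBounded, -LinearPMap.mem_graph_iff]

/-- A closed operator whose domain contains the range of a bounded operator `p` becomes bounded
after composition with `p`. -/
theorem exists_eq_opComp_ofBounded [CompleteSpace H] {x : H →ₗ.[ℂ] H} (hx : x.IsClosed)
    {p : H →L[ℂ] H} (hp : ∀ ξ, p ξ ∈ x.domain) :
    ∃ b : H →L[ℂ] H, opComp x (ofBounded p) = ofBounded b := by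
  let f : H →ₗ[ℂ] H := x.toFun.comp ((p : H →ₗ[ℂ] H).codRestrict x.domain hp)
  have hf : ∀ ξ, (p ξ, f ξ) ∈ x.graph := fun ξ => x.mem_graph ⟨p ξ, hp ξ⟩
  have hgr : ∀ ξ η, (p ξ, η) ∈ x.graph ↔ f ξ = η := fun ξ η =>
    ⟨fun h => graph_unique (hf ξ) h, fun h => h ▸ hf ξ⟩
  have hcl : IsClosed (f.graph : Set (H × H)) := by
    have : (f.graph : Set (H × H)) = (fun v : H × H => (p v.1, v.2)) ⁻¹' x.graph := by
      ext ⟨ξ, η⟩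
      simp only [SetLike.mem_coe, LinearMap.mem_graph_iff, mem_preimage, hgr]
      exact eq_comm
    rw [this]
    exact IsClosed.preimage (by fun_prop) hx
  refine ⟨⟨f, f.continuous_of_isClosed_graph hcl⟩, ?_⟩
  apply ext_graph
  intro ξ η
  simp only [mem_graph_opComp, mem_graph_ofBounded, exists_eq_left', hgr]
  rfl

/-- The graph condition determines `r ξ` for every `ξ`, so the choice in `onePlusInv` is harmless.
-/
theorem onePlusInv_eq_of_forall {a : H →ₗ.[ℂ] H} {r : H →L[ℂ] H}
    (h : ∀ ξ η : H, r ξ = η ↔ (η, ξ - η) ∈ a.graph) : onePlusInv a = r := by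
  have hex : ∃ r : H →L[ℂ] H, ∀ ξ η : H, r ξ = η ↔ (η, ξ - η) ∈ a.graph := ⟨r, h⟩
  rw [onePlusInv, dif_pos hex]
  ext ξ
  exact (hex.choose_spec ξ _).2 ((h ξ _).1 rfl)

end PartialOperators

/-! ### Projections and the trace in a von Neumann algebra. -/

section VonNeumann

variable {H : Type*} [NormedAddCommGroup H] [InnerProductSpace ℂ H] [CompleteSpace H]
  {M : VonNeumannAlgebra H}

/-- By the bicommutant property, `M` is cut out by the norm-closed conditions `g a = a g`. -/
theorem isClosed_toStarSubalgebra (M : VonNeumannAlgebra H) :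
    IsClosed (M.toStarSubalgebra : Set (H →L[ℂ] H)) := by
  have : (M.toStarSubalgebra : Set (H →L[ℂ] H)) =
      ⋂ g ∈ M.commutant, {a : H →L[ℂ] H | g * a = a * g} := by
    ext a
    rw [VonNeumannAlgebra.coe_toStarSubalgebra, SetLike.mem_coe]
    conv_lhs => rw [← VonNeumannAlgebra.commutant_commutant M]
    simp only [VonNeumannAlgebra.mem_commutant_iff (S := M.commutant), mem_iInter, mem_ofPred_eq]
  rw [this]
  exact isClosed_biInter fun g _ => isClosed_eq (by fun_prop) (by fun_prop)

theorem mem_commutant_of_isCommutative (hM : IsCommutative M) {a : H →L[ℂ] H} (ha : a ∈ M) :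
    a ∈ M.commutant :=
  VonNeumannAlgebra.mem_commutant_iff.2 fun g hg => hM g hg a ha

/-- A von Neumann algebra is spanned by its unitaries. -/
theorem mem_span_unitary {a : H →L[ℂ] H} (ha : a ∈ M) :
    a ∈ Submodule.span ℂ {u : H →L[ℂ] H | u ∈ M ∧ u ∈ unitary (H →L[ℂ] H)} := by
  have := isClosed_toStarSubalgebra M
  have h : (⟨a, ha⟩ : M.toStarSubalgebra) ∈
      Submodule.span ℂ (unitary M.toStarSubalgebra : Set M.toStarSubalgebra) := by
    rw [CStarAlgebra.span_unitary]; trivial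
  have := Submodule.mem_map_of_mem (f := M.toStarSubalgebra.subtype.toAlgHom.toLinearMap) h
  rw [Submodule.map_span] at this
  refine Submodule.span_mono ?_ this
  rintro _ ⟨u, hu, rfl⟩
  refine ⟨u.2, ?_⟩
  have := Unitary.mem_iff.1 hu
  rw [Unitary.mem_iff]
  exact ⟨congrArg Subtype.val this.1, congrArg Subtype.val this.2⟩

/-- An affiliated operator commutes with every element of the commutant. -/
theorem IsAffiliated.mem_graph {x : H →ₗ.[ℂ] H} (hx : IsAffiliated M x) {a : H →L[ℂ] H}
    (ha : a ∈ M.commutant) {ξ η : H} (h : (ξ, η) ∈ x.graph) : (a ξ, a η) ∈ x.graph := by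
  have hspan := mem_span_unitary ha
  clear ha
  induction hspan using Submodule.span_induction with
  | mem u hu =>
    obtain ⟨ζ, rfl, rfl⟩ := (LinearPMap.mem_graph_iff _).1 h
    obtain ⟨h1, h2⟩ := hx u hu.1 hu.2 ζ
    rw [h2]
    exact x.mem_graph ⟨_, h1⟩
  | zero => exact x.graph.zero_mem
  | add u v _ _ hu hv => exact x.graph.add_mem hu hv
  | smul c u _ hu => exact x.graph.smul_mem c hu

theorem starProjection_mem {K : Submodule ℂ H} [K.HasOrthogonalProjection]
    (hK : ∀ a ∈ M.commutant, ∀ ξ ∈ K, a ξ ∈ K) : K.starProjection ∈ M := by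
  rw [VonNeumannAlgebra.IsStarProjection.mem_iff isStarProjection_starProjection]
  intro y hy
  rw [Submodule.range_starProjection]
  exact hK y hy

theorem one_sub_mem_projections {p : H →L[ℂ] H} (hp : p ∈ projections M) :
    1 - p ∈ projections M :=
  ⟨sub_mem (one_mem _) hp.1, hp.2.one_sub⟩

theorem projections_nonneg {p : H →L[ℂ] H} (hp : p ∈ projections M) : 0 ≤ p := hp.2.nonneg

theorem posTrace_of_mem (τ : M.toStarSubalgebra →ₗ[ℂ] ℂ) (a : M.toStarSubalgebra) :
    posTrace M τ (a : H →L[ℂ] H) = ENNReal.ofReal (τ a).re := by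
  rw [posTrace, dif_pos a.2]

variable {τ : M.toStarSubalgebra →ₗ[ℂ] ℂ}

theorem IsFaithfulNormalFiniteTrace.mono (hτ : IsFaithfulNormalFiniteTrace M τ)
    {a b : M.toStarSubalgebra} (h : (a : H →L[ℂ] H) ≤ b) : (τ a).re ≤ (τ b).re := by
  have := (hτ.nonneg (b - a) (sub_nonneg.2 h)).1
  rw [map_sub, Complex.sub_re] at this
  linarith

/-- A closed subspace that is invariant under the commutant and contains the ranges of projections
of trace arbitrarily close to the full trace is the whole space. -/
theorem eq_top_of_forall_exists_projection (hτ : IsFaithfulNormalFiniteTrace M τ)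
    {K : Submodule ℂ H} (hcl : IsClosed (K : Set H))
    (hK : ∀ a ∈ M.commutant, ∀ ξ ∈ K, a ξ ∈ K)
    (h : ∀ ε : ℝ≥0∞, 0 < ε → ∃ p ∈ projections M, (∀ ξ : H, p ξ ∈ K) ∧ posTrace M τ (1 - p) < ε) :
    K = ⊤ := by
  have : CompleteSpace K := hcl.completeSpace_coe
  have hP : K.starProjection ∈ M := starProjection_mem hK
  set P : M.toStarSubalgebra := ⟨K.starProjection, hP⟩
  have hnn : (0 : H →L[ℂ] H) ≤ ((1 - P : M.toStarSubalgebra) : H →L[ℂ] H) :=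
    projections_nonneg (one_sub_mem_projections ⟨hP, isStarProjection_starProjection⟩)
  have h0 : ENNReal.ofReal (τ (1 - P)).re = 0 := by
    -- Take `ε = τ(1 - P)`: a projection `p` with range in `K` lies below `P`, so `τ(1 - P) ≤ τ(1 -
    -- p) < ε`, which is absurd.
    by_contra hne
    obtain ⟨p, hp, hpK, hlt⟩ := h _ (pos_iff_ne_zero.2 hne)
    refine absurd hlt (not_lt.2 ?_)
    have := posTrace_of_mem τ (1 - ⟨p, hp.1⟩ : M.toStarSubalgebra)
    refine le_of_le_of_eq (ENNReal.ofReal_le_ofReal (hτ.mono ?_)) this.symm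
    refine sub_le_sub_left ?_ _
    refine (hp.2.le_iff_mul_eq_right isStarProjection_starProjection).2 ?_
    ext ξ
    exact Submodule.starProjection_eq_self_iff.2 (hpK ξ)
  have hre : (τ (1 - P)).re = 0 :=
    le_antisymm (ENNReal.ofReal_eq_zero.1 h0) (hτ.nonneg _ hnn).1
  have hz : τ (1 - P) = 0 := Complex.ext hre (hτ.nonneg _ hnn).2
  have hone : (1 : M.toStarSubalgebra) - P = 0 := hτ.faithful _ hnn hz
  rw [eq_top_iff]
  intro ξ _
  have : K.starProjection ξ = ξ := by
    have := congrArg (fun a : M.toStarSubalgebra => (a : H →L[ℂ] H) ξ) (sub_eq_zero.1 hone)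
    exact this.symm
  exact Submodule.starProjection_eq_self_iff.1 this

/-- The support projection: the projection onto the closure of the range of `c`. -/
theorem exists_support_projection (c : M.toStarSubalgebra) :
    ∃ e : M.toStarSubalgebra, (e : H →L[ℂ] H) ∈ projections M ∧ e * c = c ∧
      ∀ d : M.toStarSubalgebra, d * c = 0 → d * e = 0 := by
  set K : Submodule ℂ H := ((c : H →L[ℂ] H) : H →ₗ[ℂ] H).range.topologicalClosure
  have : CompleteSpace K := (Submodule.isClosed_topologicalClosure _).completeSpace_coe
  have hKcl : IsClosed (K : Set H) := Submodule.isClosed_topologicalClosure _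
  have hcK : ∀ ξ, (c : H →L[ℂ] H) ξ ∈ K := fun ξ =>
    Submodule.le_topologicalClosure _ ⟨ξ, rfl⟩
  have hmin : ∀ L : Submodule ℂ H, IsClosed (L : Set H) → (∀ ξ, (c : H →L[ℂ] H) ξ ∈ L) → K ≤ L := by
    intro L hL h
    refine Submodule.topologicalClosure_minimal _ ?_ hL
    rintro _ ⟨ξ, rfl⟩
    exact h ξ
  have hinv : ∀ a ∈ M.commutant, ∀ ξ ∈ K, a ξ ∈ K := by
    intro a ha
    refine hmin (K.comap (a : H →ₗ[ℂ] H)) (hKcl.preimage a.continuous) fun ξ => ?_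
    have := VonNeumannAlgebra.mem_commutant_iff.1 ha c c.2
    have h2 : (c : H →L[ℂ] H) (a ξ) = a ((c : H →L[ℂ] H) ξ) :=
      congrArg (fun b : H →L[ℂ] H => b ξ) this
    change a ((c : H →L[ℂ] H) ξ) ∈ K
    rw [← h2]
    exact hcK _
  refine ⟨⟨K.starProjection, starProjection_mem hinv⟩,
    ⟨starProjection_mem hinv, isStarProjection_starProjection⟩, ?_, ?_⟩
  · ext ξ
    exact Submodule.starProjection_eq_self_iff.2 (hcK ξ)
  · intro d hd
    have : K ≤ ((d : H →L[ℂ] H) : H →ₗ[ℂ] H).ker := by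
      refine hmin _ (d : H →L[ℂ] H).isClosed_ker fun ξ => ?_
      exact congrArg (fun b : M.toStarSubalgebra => (b : H →L[ℂ] H) ξ) hd
    ext ξ
    exact this (K.starProjection_apply_mem ξ)

/-! ### Gelfand duality for commutative `M`. -/

section Characters

/-- The commutative C⋆-algebra structure of a commutative von Neumann algebra. -/
abbrev commCStarAlgebra (hM : IsCommutative M) : CommCStarAlgebra M.toStarSubalgebra where
  __ := StarSubalgebra.cstarAlgebra M.toStarSubalgebra (h_closed := isClosed_toStarSubalgebra M)
  mul_comm a b := Subtype.ext (hM a a.2 b b.2)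

theorem mul_comm_of_isCommutative (hM : IsCommutative M) (a b : M.toStarSubalgebra) :
    a * b = b * a := Subtype.ext (hM a a.2 b b.2)

/-- Injectivity of the Gelfand transform; it reduces identities in `M` to identities between complex
numbers. -/
theorem eq_of_forall_character (hM : IsCommutative M) {a b : M.toStarSubalgebra}
    (h : ∀ χ : M.toStarSubalgebra →⋆ₐ[ℂ] ℂ, χ a = χ b) : a = b := by
  let _ := commCStarAlgebra hM
  apply (gelfandStarTransform M.toStarSubalgebra).injective
  ext χ
  exact h (StarAlgHomClass.toStarAlgHom χ)

theorem exists_character_eq (hM : IsCommutative M) (a : M.toStarSubalgebra) {z : ℂ}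
    (hz : z ∈ spectrum ℂ a) : ∃ χ : M.toStarSubalgebra →⋆ₐ[ℂ] ℂ, χ a = z := by
  let _ := commCStarAlgebra hM
  obtain ⟨χ, hχ⟩ := WeakDual.CharacterSpace.mem_spectrum_iff_exists.1 hz
  exact ⟨StarAlgHomClass.toStarAlgHom χ, hχ⟩

theorem norm_character_le (χ : M.toStarSubalgebra →⋆ₐ[ℂ] ℂ) (a : M.toStarSubalgebra) :
    ‖χ a‖ ≤ ‖(a : H →L[ℂ] H)‖ :=
  have := isClosed_toStarSubalgebra M
  NonUnitalStarAlgHom.norm_apply_le χ a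

/-- Continuous functional calculus, expressed through characters. -/
theorem exists_forall_character_eq (hM : IsCommutative M) (a : M.toStarSubalgebra) {g : ℂ → ℂ}
    (hg : Continuous g) :
    ∃ b : M.toStarSubalgebra, ∀ χ : M.toStarSubalgebra →⋆ₐ[ℂ] ℂ, χ b = g (χ a) := by
  have := isClosed_toStarSubalgebra M
  have : IsStarNormal a := ⟨mul_comm_of_isCommutative hM _ _⟩
  refine ⟨cfc g a, fun χ => ?_⟩
  have hχ : Continuous χ := (AddMonoidHomClass.continuous_of_bound χ 1 fun b => by
    simpa using norm_character_le χ b)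
  have : IsStarNormal (χ a) := ⟨mul_comm _ _⟩
  rw [StarAlgHom.map_cfc χ g a hg.continuousOn hχ]
  exact cfc_algebraMap (χ a) g

/-- Functional calculus gives a square root `b`, and `a = b* b` can be tested on characters. -/
theorem nonneg_of_forall_character (hM : IsCommutative M) {a : M.toStarSubalgebra}
    (h : ∀ χ : M.toStarSubalgebra →⋆ₐ[ℂ] ℂ, 0 ≤ (χ a).re ∧ (χ a).im = 0) : (0 : H →L[ℂ] H) ≤ a := by
  obtain ⟨b, hb⟩ := exists_forall_character_eq hM a (g := fun z => (Real.sqrt z.re : ℂ))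
    (by fun_prop)
  have : a = star b * b := by
    apply eq_of_forall_character hM
    intro χ
    rw [map_mul, map_star, hb]
    obtain ⟨h1, h2⟩ := h χ
    rw [Complex.star_def, Complex.conj_ofReal, ← Complex.ofReal_mul, Real.mul_self_sqrt h1]
    exact Complex.ext rfl h2
  rw [this]
  exact star_mul_self_nonneg (b : H →L[ℂ] H)

theorem character_projection {e : M.toStarSubalgebra} (he : (e : H →L[ℂ] H) ∈ projections M)
    (χ : M.toStarSubalgebra →⋆ₐ[ℂ] ℂ) : χ e = 0 ∨ χ e = 1 := by
  have h : e * e = e := Subtype.ext he.2.isIdempotentElem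
  exact IsIdempotentElem.iff_eq_zero_or_one.1 ((map_mul χ e e).symm.trans (congrArg χ h))

end Characters

end VonNeumann

/-! ### Analytic properties of Young functions. -/

section YoungFunctions

variable {φ : ℝ → ℝ}

theorem IsYoungFunction.map_zero (hφ : IsYoungFunction φ) : φ 0 = 0 := by
  obtain ⟨v, -, -, -, -, -, h⟩ := hφ
  simp [h 0 le_rfl]

theorem IsYoungFunction.exists_density (hφ : IsYoungFunction φ) :
    ∃ v : ℝ → ℝ, MonotoneOn v (Ici 0) ∧ (∀ s, 0 ≤ s → 0 ≤ v s) ∧ (∀ s, 0 < s → 0 < v s) ∧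
      ∀ t, 0 ≤ t → φ t = ∫ s in (0 : ℝ)..t, v s := by
  obtain ⟨v, h0, hpos, -, -, hmono, h⟩ := hφ
  have hnn : ∀ s, 0 ≤ s → 0 ≤ v s := fun s hs => by
    rcases hs.eq_or_lt with rfl | hs
    · exact h0.ge
    · exact (hpos s hs).le
  refine ⟨v, fun s hs t ht hst => ?_, hnn, hpos, h⟩
  rcases (mem_Ici.1 hs).eq_or_lt with rfl | hs
  · rw [h0]; exact hnn t ht
  · exact hmono hs (hs.trans_le hst) hst

theorem IsYoungFunction.exists_integrable_density (hφ : IsYoungFunction φ) :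
    ∃ v : ℝ → ℝ, MonotoneOn v (Ici 0) ∧ (∀ s, 0 ≤ s → 0 ≤ v s) ∧ (∀ s, 0 < s → 0 < v s) ∧
      (∀ a b, 0 ≤ a → 0 ≤ b → IntervalIntegrable v MeasureTheory.volume a b) ∧
      ∀ t, 0 ≤ t → φ t = ∫ s in (0 : ℝ)..t, v s := by
  obtain ⟨v, hmono, hnn, hpos, h⟩ := hφ.exists_density
  refine ⟨v, hmono, hnn, hpos, fun a b ha hb => ?_, h⟩
  exact (hmono.mono fun s hs => (le_min ha hb).trans hs.1).intervalIntegrable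

theorem IsYoungFunction.monotoneOn (hφ : IsYoungFunction φ) : MonotoneOn φ (Ici 0) := by
  obtain ⟨v, hmono, hnn, hpos, hint, h⟩ := hφ.exists_integrable_density
  intro s hs t ht hst
  rw [h s hs, h t ht, ← sub_nonneg,
    intervalIntegral.integral_interval_sub_left (hint _ _ le_rfl ht) (hint _ _ le_rfl hs)]
  exact intervalIntegral.integral_nonneg hst fun u hu => hnn u (le_trans hs hu.1)

theorem IsYoungFunction.nonneg (hφ : IsYoungFunction φ) {t : ℝ} (ht : 0 ≤ t) : 0 ≤ φ t :=
  hφ.map_zero.symm.le.trans (hφ.monotoneOn self_mem_Ici ht ht)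

theorem IsYoungFunction.continuousOn (hφ : IsYoungFunction φ) : ContinuousOn φ (Ici 0) := by
  obtain ⟨v, hmono, hnn, hpos, hint, h⟩ := hφ.exists_integrable_density
  intro t ht
  have ht : 0 ≤ t := ht
  have hc : ContinuousOn φ (Icc 0 (t + 1)) := by
    have hi := hint 0 (t + 1) le_rfl (by linarith)
    have := intervalIntegral.continuousOn_primitive_interval'
      (μ := MeasureTheory.volume) hi (left_mem_uIcc)
    rw [uIcc_of_le (by linarith)] at this
    exact this.congr fun s hs => h s hs.1
  refine (hc t ⟨ht, by linarith⟩).mono_of_mem_nhdsWithin ?_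
  rw [← Ici_inter_Iic]
  exact inter_mem_nhdsWithin _ (Iic_mem_nhds (by linarith))

theorem IsYoungFunction.tendsto_atTop (hφ : IsYoungFunction φ) : Tendsto φ atTop atTop := by
  obtain ⟨v, hmono, hnn, hpos, hint, h⟩ := hφ.exists_integrable_density
  -- Beyond `1` the density is at least `v 1 > 0`, so growth is at least linear.
  have hlin : ∀ t, 1 ≤ t → v 1 * (t - 1) ≤ φ t := by
    intro t ht
    have h1 := hφ.nonneg zero_le_one
    have h2 : φ t - φ 1 = ∫ s in (1 : ℝ)..t, v s := by
      rw [h t (by linarith), h 1 zero_le_one, intervalIntegral.integral_interval_sub_left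
        (hint _ _ le_rfl (by linarith)) (hint _ _ le_rfl zero_le_one)]
    have h3 : (∫ _ in (1 : ℝ)..t, v 1) ≤ ∫ s in (1 : ℝ)..t, v s :=
      intervalIntegral.integral_mono_on ht (by simp) (hint _ _ zero_le_one (by linarith))
        fun s hs => hmono (mem_Ici.2 zero_le_one) (mem_Ici.2 (zero_le_one.trans hs.1)) hs.1
    rw [intervalIntegral.integral_const, smul_eq_mul] at h3
    linarith
  refine tendsto_atTop_mono' _ (eventually_ge_atTop 1 |>.mono hlin) ?_
  exact (tendsto_atTop_add_const_right _ _ tendsto_id).const_mul_atTop (hpos 1 one_pos)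

/-- The function of `(1 + |x|²)⁻¹` that represents `min(φ, N)(|x|)`. -/
theorem IsYoungFunction.continuousOn_truncated (hφ : IsYoungFunction φ) (N : ℝ) :
    ContinuousOn (fun s : ℝ => if s = 0 then N else min (φ (Real.sqrt (s⁻¹ - 1))) N) (Ici 0) := by
  intro s hs
  rcases (mem_Ici.1 hs).eq_or_lt with rfl | hs
  · refine ContinuousWithinAt.congr_of_eventuallyEq (f := fun _ => N)
      continuousWithinAt_const ?_ (by simp)
    -- As `s → 0+` the argument of `φ` tends to infinity, so the truncation is constantly `N` near
    -- `0`, matching the value assigned there.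
    have ht : Tendsto (fun s : ℝ => φ (Real.sqrt (s⁻¹ - 1))) (nhdsWithin 0 (Ioi 0)) atTop :=
      hφ.tendsto_atTop.comp (Real.tendsto_sqrt_atTop.comp
        (tendsto_atTop_add_const_right _ _ tendsto_inv_nhdsGT_zero))
    have h1 := ht.eventually_ge_atTop N
    rw [eventually_nhdsWithin_iff] at h1
    refine eventually_nhdsWithin_iff.2 (h1.mono fun s h hs => ?_)
    dsimp only
    split_ifs with h0
    · rfl
    · exact min_eq_right (h (lt_of_le_of_ne hs (Ne.symm h0)))
  · have hcont : ContinuousAt (fun s : ℝ => min (φ (Real.sqrt (s⁻¹ - 1))) N) s := by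
      refine Filter.Tendsto.min ?_ tendsto_const_nhds
      have h1 : ContinuousWithinAt φ (Ici 0) (Real.sqrt (s⁻¹ - 1)) :=
        hφ.continuousOn _ (Real.sqrt_nonneg _)
      have h2 : ContinuousAt (fun s : ℝ => Real.sqrt (s⁻¹ - 1)) s :=
        Real.continuous_sqrt.continuousAt.comp
          ((continuousAt_inv₀ hs.ne').sub continuousAt_const)
      exact h1.tendsto.comp (tendsto_nhdsWithin_iff.2
        ⟨h2, Eventually.of_forall fun _ => Real.sqrt_nonneg _⟩)
    refine (hcont.congr ?_).continuousWithinAt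
    filter_upwards [lt_mem_nhds hs] with t ht
    rw [if_neg ht.ne']

end YoungFunctions

/-! ### Measurable operators and their bounded cut-downs. -/

section Measurable

variable {H : Type*} [NormedAddCommGroup H] [InnerProductSpace ℂ H] [CompleteSpace H]
  {M : VonNeumannAlgebra H} {τ : M.toStarSubalgebra →ₗ[ℂ] ℂ}

theorem smul_mem_measurableOps {x : H →ₗ.[ℂ] H} (hx : x ∈ measurableOps M τ) {c : ℂ}
    (hc : c ≠ 0) : c • x ∈ measurableOps M τ := by
  refine ⟨isClosed_smul hx.1 hc, ?_, hx.2.2⟩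
  intro u hu hu' ξ
  obtain ⟨h1, h2⟩ := hx.2.1 u hu hu' ξ
  refine ⟨h1, ?_⟩
  rw [LinearPMap.smul_apply, LinearPMap.smul_apply, map_smul, h2]

theorem ofBounded_mem_measurableOps {a : H →L[ℂ] H} (ha : a ∈ M) :
    ofBounded a ∈ measurableOps M τ := by
  refine ⟨isClosed_ofBounded a, fun u hu _ ξ => ⟨trivial, ?_⟩, fun ε hε =>
    ⟨1, ⟨one_mem _, IsStarProjection.one _⟩, fun _ => trivial, ?_⟩⟩
  · have := VonNeumannAlgebra.mem_commutant_iff.1 hu a ha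
    exact (congrArg (fun b : H →L[ℂ] H => b ξ) this).symm
  · have := posTrace_of_mem τ (0 : M.toStarSubalgebra)
    rw [sub_self]
    refine lt_of_eq_of_lt this ?_
    simpa using hε

theorem mem_graph_of_mem (hM : IsCommutative M) {x : H →ₗ.[ℂ] H} (hx : x ∈ measurableOps M τ)
    {a : H →L[ℂ] H} (ha : a ∈ M) {ξ η : H} (h : (ξ, η) ∈ x.graph) : (a ξ, a η) ∈ x.graph :=
  hx.2.1.mem_graph (mem_commutant_of_isCommutative hM ha) h

/-- The closure of the domain is invariant under the commutant and contains the ranges of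
projections of almost full trace. -/
theorem dense_domain (hτ : IsFaithfulNormalFiniteTrace M τ) {x : H →ₗ.[ℂ] H}
    (hx : x ∈ measurableOps M τ) : Dense (x.domain : Set H) := by
  rw [Submodule.dense_iff_topologicalClosure_eq_top]
  refine eq_top_of_forall_exists_projection hτ (Submodule.isClosed_topologicalClosure _) ?_ ?_
  · intro a ha
    have : x.domain.topologicalClosure ≤
        x.domain.topologicalClosure.comap (a : H →ₗ[ℂ] H) := by
      refine Submodule.topologicalClosure_minimal _ (fun ξ hξ => ?_)
        ((Submodule.isClosed_topologicalClosure _).preimage a.continuous)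
      exact Submodule.le_topologicalClosure _
        (LinearPMap.mem_domain_of_mem_graph (hx.2.1.mem_graph ha (x.mem_graph ⟨ξ, hξ⟩)))
    exact this
  · intro ε hε
    obtain ⟨p, hp, h1, h2⟩ := hx.2.2 ε hε
    exact ⟨p, hp, fun ξ => Submodule.le_topologicalClosure _ (h1 ξ), h2⟩

/-- The vectors `ξ` with `(ξ, 0)` in the graph form a closed subspace invariant under the commutant,
to which `eq_top_of_forall_exists_projection` applies. -/
theorem eq_zero_of_forall_projection (hτ : IsFaithfulNormalFiniteTrace M τ) {x : H →ₗ.[ℂ] H}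
    (hx : x ∈ measurableOps M τ)
    (h : ∀ ε : ℝ≥0∞, 0 < ε → ∃ p ∈ projections M,
      (∀ ξ, (p ξ, (0 : H)) ∈ x.graph) ∧ posTrace M τ (1 - p) < ε) : x = 0 := by
  have htop : x.graph.comap (LinearMap.inl ℂ H H) = ⊤ := by
    refine eq_top_of_forall_exists_projection hτ ?_ (fun a ha ξ hξ => ?_) h
    · exact hx.1.preimage (f := fun ξ : H => (ξ, (0 : H))) (by fun_prop)
    · have := hx.2.1.mem_graph ha (ξ := ξ) (η := 0) hξ
      rwa [map_zero] at this
  have h0 : ∀ ξ, (ξ, (0 : H)) ∈ x.graph := fun ξ => by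
    have : ξ ∈ x.graph.comap (LinearMap.inl ℂ H H) := htop ▸ Submodule.mem_top
    exact this
  rw [← ofBounded_zero]
  refine ext_graph fun ξ η => ?_
  rw [mem_graph_ofBounded]
  exact ⟨fun h => graph_unique (h0 ξ) h, fun h => h ▸ h0 ξ⟩

/-- Vanishing values alone leave the domain open; measurability forces it to be all of `H`. -/
theorem eq_zero_of_forall_mem_graph (hτ : IsFaithfulNormalFiniteTrace M τ) {x : H →ₗ.[ℂ] H}
    (hx : x ∈ measurableOps M τ) (h : ∀ ξ η, (ξ, η) ∈ x.graph → η = 0) : x = 0 := by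
  refine eq_zero_of_forall_projection hτ hx fun ε hε => ?_
  obtain ⟨p, hp, h1, h2⟩ := hx.2.2 ε hε
  refine ⟨p, hp, fun ξ => ?_, h2⟩
  have := x.mem_graph ⟨p ξ, h1 ξ⟩
  rwa [h _ _ this] at this

/-- Cutting a measurable operator down to a projection whose range lies in its domain gives an
element of the von Neumann algebra. -/
theorem exists_mem_opComp_eq_ofBounded {x : H →ₗ.[ℂ] H} (hx : x ∈ measurableOps M τ)
    {p : H →L[ℂ] H} (hp : p ∈ M) (hpx : ∀ ξ, p ξ ∈ x.domain) :
    ∃ b ∈ M, opComp x (ofBounded p) = ofBounded b := by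
  obtain ⟨b, hb⟩ := exists_eq_opComp_ofBounded hx.1 hpx
  refine ⟨b, ?_, hb⟩
  have hg : ∀ ξ η, (p ξ, η) ∈ x.graph ↔ b ξ = η := fun ξ η => by
    rw [← mem_graph_ofBounded, ← hb]
    simp only [mem_graph_opComp, mem_graph_ofBounded, exists_eq_left']
  rw [← VonNeumannAlgebra.commutant_commutant M, VonNeumannAlgebra.mem_commutant_iff]
  intro a ha
  ext ξ
  have h1 := hx.2.1.mem_graph ha ((hg ξ _).2 rfl)
  have h2 : a (p ξ) = p (a ξ) := by
    have := VonNeumannAlgebra.mem_commutant_iff.1 ha p hp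
    exact (congrArg (fun b : H →L[ℂ] H => b ξ) this).symm
  rw [h2] at h1
  exact ((hg _ _).1 h1).symm

end Measurable

/-! ### Functional calculus of bounded elements, and `M` inside the Arens algebra. -/

section Calculus

variable {H : Type*} [NormedAddCommGroup H] [InnerProductSpace ℂ H] [CompleteSpace H]
  {M : VonNeumannAlgebra H} {τ : M.toStarSubalgebra →ₗ[ℂ] ℂ}

theorem character_mem_spectrum (χ : M.toStarSubalgebra →⋆ₐ[ℂ] ℂ) (a : M.toStarSubalgebra) :
    χ a ∈ spectrum ℂ (a : H →L[ℂ] H) := by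
  have := isClosed_toStarSubalgebra M
  rw [← StarSubalgebra.spectrum_eq M.toStarSubalgebra (a := a)]
  exact AlgHom.apply_mem_spectrum χ a

theorem character_nonneg {a : M.toStarSubalgebra} (ha : (0 : H →L[ℂ] H) ≤ a)
    (χ : M.toStarSubalgebra →⋆ₐ[ℂ] ℂ) : 0 ≤ (χ a).re ∧ (χ a).im = 0 := by
  have hsa : star a = a := Subtype.ext (IsSelfAdjoint.of_nonneg ha).star_eq
  have him : (χ a).im = 0 := by
    have := congrArg χ hsa
    rw [map_star] at this
    exact Complex.conj_eq_iff_im.1 this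
  refine ⟨?_, him⟩
  have h1 : algebraMap ℝ ℂ (χ a).re ∈ spectrum ℂ (a : H →L[ℂ] H) := by
    have : algebraMap ℝ ℂ (χ a).re = χ a := Complex.ext rfl him.symm
    rw [this]
    exact character_mem_spectrum χ a
  exact spectrum_nonneg_of_nonneg ha ((spectrum.algebraMap_mem_iff ℂ).1 h1)

/-- The inclusion of `M` into the bounded operators and every character are continuous star
homomorphisms, so both commute with the functional calculus. -/
theorem exists_cfc_eq (hM : IsCommutative M) {r : M.toStarSubalgebra}
    (hr : (0 : H →L[ℂ] H) ≤ r) {F : ℝ → ℝ} (hF : ContinuousOn F (Ici 0)) :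
    ∃ g : M.toStarSubalgebra, (g : H →L[ℂ] H) = cfc F (r : H →L[ℂ] H) ∧
      ∀ χ : M.toStarSubalgebra →⋆ₐ[ℂ] ℂ, χ g = F (χ r).re := by
  have := isClosed_toStarSubalgebra M
  have hsp : spectrum ℝ r ⊆ Ici 0 := by
    intro s hs
    obtain ⟨χ, hχ⟩ := exists_character_eq hM r ((spectrum.algebraMap_mem_iff ℂ).2 hs)
    have := (character_nonneg hr χ).1
    rwa [hχ] at this
  have hsa : IsSelfAdjoint r := Subtype.ext (IsSelfAdjoint.of_nonneg hr).star_eq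
  refine ⟨cfc F r, ?_, fun χ => ?_⟩
  · exact StarAlgHom.map_cfc M.toStarSubalgebra.subtype F r (hF.mono hsp) continuous_subtype_val
  · have hχ : Continuous χ := AddMonoidHomClass.continuous_of_bound χ 1 fun b => by
      simpa using norm_character_le χ b
    rw [StarAlgHom.map_cfc χ F r (hF.mono hsp) hχ]
    have : χ r = algebraMap ℝ ℂ (χ r).re := Complex.ext rfl (character_nonneg hr χ).2
    rw [this, cfc_algebraMap]
    rfl

theorem adjoint_ofBounded (a : H →L[ℂ] H) : (ofBounded a).adjoint = ofBounded (star a) :=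
  ContinuousLinearMap.toPMap_adjoint_eq_adjoint_toPMap_of_dense a (by simp)

theorem exists_onePlusInv_eq (hM : IsCommutative M) (a : M.toStarSubalgebra) :
    ∃ r : M.toStarSubalgebra, (0 : H →L[ℂ] H) ≤ r ∧
      onePlusInv (opComp (ofBounded (a : H →L[ℂ] H)).adjoint (ofBounded (a : H →L[ℂ] H))) = r ∧
      ∀ χ : M.toStarSubalgebra →⋆ₐ[ℂ] ℂ, χ r = ((1 + ‖χ a‖ ^ 2)⁻¹ : ℝ) := by
  obtain ⟨r, hr⟩ := exists_forall_character_eq hM a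
    (g := fun z => (((1 + ‖z‖ ^ 2)⁻¹ : ℝ) : ℂ))
    (Complex.continuous_ofReal.comp (Continuous.inv₀ (by fun_prop) fun z => by positivity))
  have hinv : (1 + star a * a) * r = 1 := by
    refine eq_of_forall_character hM fun χ => ?_
    rw [map_mul, map_add, map_one, map_mul, map_star, hr, Complex.star_def,
      ← Complex.normSq_eq_conj_mul_self, Complex.normSq_eq_norm_sq]
    have : (1 + ‖χ a‖ ^ 2 : ℝ) ≠ 0 := by positivity
    rw [← Complex.ofReal_one, ← Complex.ofReal_add, ← Complex.ofReal_mul, mul_inv_cancel₀ this]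
  have hinv' : r * (1 + star a * a) = 1 := by rw [mul_comm_of_isCommutative hM, hinv]
  refine ⟨r, nonneg_of_forall_character hM fun χ => ?_, ?_, hr⟩
  · rw [hr]
    exact ⟨by rw [Complex.ofReal_re]; positivity, Complex.ofReal_im _⟩
  · rw [adjoint_ofBounded, opComp_ofBounded_ofBounded]
    apply onePlusInv_eq_of_forall
    intro ξ η
    have e1 : ∀ ξ, (r : H →L[ℂ] H) ξ + (star (a : H →L[ℂ] H) * a) ((r : H →L[ℂ] H) ξ) = ξ :=
      fun ξ => congrArg (fun b : M.toStarSubalgebra => (b : H →L[ℂ] H) ξ) hinv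
    have e2 : ∀ η, (r : H →L[ℂ] H) (η + (star (a : H →L[ℂ] H) * a) η) = η :=
      fun ξ => congrArg (fun b : M.toStarSubalgebra => (b : H →L[ℂ] H) ξ) hinv'
    rw [mem_graph_ofBounded]
    constructor
    · rintro rfl
      rw [eq_sub_iff_add_eq', e1]
    · intro h
      have := e2 η
      rwa [h, add_sub_cancel] at this

/-- On a character `χ`, the truncated `φ(|a|)` takes the value `min (φ |χ a|) N`, at most `φ ‖a‖` by
monotonicity. -/
theorem traceOfAbs_ofBounded_le (hM : IsCommutative M) (hτ : IsFaithfulNormalFiniteTrace M τ)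
    {φ : ℝ → ℝ} (hφ : IsYoungFunction φ) (a : M.toStarSubalgebra) :
    traceOfAbs M τ φ (ofBounded (a : H →L[ℂ] H)) ≤
      ENNReal.ofReal (φ ‖(a : H →L[ℂ] H)‖ * (τ 1).re) := by
  refine iSup_le fun N => ?_
  obtain ⟨r, hr0, hr, hχ⟩ := exists_onePlusInv_eq hM a
  obtain ⟨g, hg, hgχ⟩ := exists_cfc_eq hM hr0 (hφ.continuousOn_truncated N)
  rw [absCalculus, hr, ← hg, posTrace_of_mem]
  refine ENNReal.ofReal_le_ofReal ?_
  have hle : (g : H →L[ℂ] H) ≤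
      (((φ ‖(a : H →L[ℂ] H)‖ : ℂ) • (1 : M.toStarSubalgebra) : M.toStarSubalgebra) :
        H →L[ℂ] H) := by
    rw [← sub_nonneg]
    refine nonneg_of_forall_character hM
      (a := (φ ‖(a : H →L[ℂ] H)‖ : ℂ) • (1 : M.toStarSubalgebra) - g) fun χ => ?_
    rw [map_sub, map_smul, map_one, hgχ, hχ, Complex.ofReal_re, smul_eq_mul, mul_one,
      if_neg (by positivity), inv_inv, add_sub_cancel_left, Real.sqrt_sq (norm_nonneg _),
      ← Complex.ofReal_sub]
    refine ⟨?_, Complex.ofReal_im _⟩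
    rw [Complex.ofReal_re, sub_nonneg]
    exact (min_le_left _ _).trans
      (hφ.monotoneOn (norm_nonneg _) (norm_nonneg _) (norm_character_le χ a))
  have := hτ.mono hle
  rwa [map_smul, smul_eq_mul, Complex.re_ofReal_mul] at this

/-- Every element of the von Neumann algebra lies in the generalized Arens algebra. -/
theorem ofBounded_mem_arensAlgebra (hM : IsCommutative M) (hτ : IsFaithfulNormalFiniteTrace M τ)
    {Λ : Set (ℝ → ℝ)} (hΛ : IsQuadraticFamily Λ) (a : M.toStarSubalgebra) :
    ofBounded (a : H →L[ℂ] H) ∈ arensAlgebra M τ Λ := by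
  intro φ hφ
  have hφ := hΛ.young φ hφ
  -- Since `φ` is continuous at `0` with `φ 0 = 0`, dividing `a` by a large `n` puts it in the unit
  -- ball `K_φ`.
  have hlim : Tendsto (fun n : ℕ => φ (‖(a : H →L[ℂ] H)‖ / n) * (τ 1).re) atTop (nhds 0) := by
    have h1 : Tendsto φ (nhdsWithin 0 (Ici 0)) (nhds 0) := by
      have := hφ.continuousOn 0 self_mem_Ici
      rwa [ContinuousWithinAt, hφ.map_zero] at this
    have h2 : Tendsto (fun n : ℕ => ‖(a : H →L[ℂ] H)‖ / n) atTop (nhdsWithin 0 (Ici 0)) :=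
      tendsto_nhdsWithin_iff.2 ⟨tendsto_const_div_atTop_nhds_zero_nat _,
        Eventually.of_forall fun n => by simp only [mem_Ici]; positivity⟩
    have := (h1.comp h2).mul_const (τ 1).re
    rwa [zero_mul] at this
  obtain ⟨n, hn, hn1⟩ := ((hlim.eventually_lt_const one_pos).and (eventually_ge_atTop 1)).exists
  have hn0 : (n : ℂ) ≠ 0 := Nat.cast_ne_zero.2 (by omega)
  refine ⟨n, hn1, ofBounded (((n : ℂ)⁻¹ • a : M.toStarSubalgebra) : H →L[ℂ] H),
    ⟨ofBounded_mem_measurableOps ((n : ℂ)⁻¹ • a).2, ?_⟩, ?_⟩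
  · refine (traceOfAbs_ofBounded_le hM hτ hφ _).trans ?_
    rw [← ENNReal.ofReal_one]
    refine ENNReal.ofReal_le_ofReal ?_
    have : ‖(((n : ℂ)⁻¹ • a : M.toStarSubalgebra) : H →L[ℂ] H)‖ = ‖(a : H →L[ℂ] H)‖ / n := by
      change ‖(n : ℂ)⁻¹ • (a : H →L[ℂ] H)‖ = _
      rw [norm_smul, norm_inv, Complex.norm_natCast, div_eq_inv_mul]
    rw [this]
    exact hn.le
  · rw [smul_ofBounded]
    congr 1
    exact (smul_inv_smul₀ hn0 (a : H →L[ℂ] H)).symm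

theorem mem_measurableOps_of_mem_arensAlgebra {Λ : Set (ℝ → ℝ)} (hΛ : IsQuadraticFamily Λ)
    {x : H →ₗ.[ℂ] H} (hx : x ∈ arensAlgebra M τ Λ) : x ∈ measurableOps M τ := by
  obtain ⟨φ, hφ⟩ := hΛ.nonempty
  obtain ⟨n, hn, y, hy, rfl⟩ := hx φ hφ
  exact smul_mem_measurableOps hy.1 (Nat.cast_ne_zero.2 (by omega))

end Calculus

/-! ### The resolvent of `x* x` and Chebyshev's inequality. -/

section LowerBound

variable {H : Type*} [NormedAddCommGroup H] [InnerProductSpace ℂ H] [CompleteSpace H]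

theorem mem_graph_adjoint {x : H →ₗ.[ℂ] H} (hx : Dense (x.domain : Set H)) {ξ η : H} :
    (ξ, η) ∈ x.adjoint.graph ↔ ∀ u v, (u, v) ∈ x.graph → inner ℂ v ξ = inner ℂ u η := by
  rw [LinearPMap.adjoint_graph_eq_graph_adjoint hx, Submodule.mem_adjoint_iff]
  simp only [sub_eq_zero]

/-- The theorem of von Neumann: for a closed densely defined operator `x`, the operator `1 + x* x` has
an everywhere defined bounded inverse. -/
theorem exists_inverse_one_add {x : H →ₗ.[ℂ] H} (hx : x.IsClosed)
    (hd : Dense (x.domain : Set H)) :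
    ∃ r : H →L[ℂ] H, ∀ ξ η : H, r ξ = η ↔ (η, ξ - η) ∈ (opComp x.adjoint x).graph := by
  -- The plain product carries the sup norm, so the graph is moved to the Hilbert sum, where `(ξ,
  -- 0)` can be projected orthogonally onto it. The first component of the projection is `r ξ`;
  -- orthogonality of the remainder to the graph says `x* x (r ξ) = ξ - r ξ`.
  let e := WithLp.prodContinuousLinearEquiv 2 ℂ H H
  let G : Submodule ℂ (WithLp 2 (H × H)) := x.graph.comap (e : WithLp 2 (H × H) →ₗ[ℂ] H × H)
  have hG : IsClosed (G : Set (WithLp 2 (H × H))) := hx.preimage e.continuous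
  have : CompleteSpace G := hG.completeSpace_coe
  let r : H →L[ℂ] H := (ContinuousLinearMap.fst ℂ H H).comp
    ((e : WithLp 2 (H × H) →L[ℂ] H × H).comp (G.starProjection.comp
      ((e.symm : H × H →L[ℂ] WithLp 2 (H × H)).comp (ContinuousLinearMap.inl ℂ H H))))
  have hr : ∀ ξ, (r ξ, ξ - r ξ) ∈ (opComp x.adjoint x).graph := by
    intro ξ
    have h1 : e (G.starProjection (e.symm (ξ, 0))) ∈ x.graph :=
      G.starProjection_apply_mem (e.symm (ξ, 0))
    rw [mem_graph_opComp]
    refine ⟨(e (G.starProjection (e.symm (ξ, 0)))).2, h1, ?_⟩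
    rw [mem_graph_adjoint hd]
    intro u v huv
    have h2 := G.sub_starProjection_mem_orthogonal (e.symm (ξ, 0))
    have h3 := (Submodule.mem_orthogonal _ _).1 h2 (e.symm (u, v)) (by simpa [G] using huv)
    rw [WithLp.prod_inner_apply] at h3
    change inner ℂ u (ξ - r ξ) + inner ℂ v (0 - _) = 0 at h3
    rw [zero_sub, inner_neg_right, ← sub_eq_add_neg, sub_eq_zero] at h3
    exact h3.symm
  -- Injectivity of `1 + x* x`: from `x* x η = -η` one gets `‖x η‖² = -‖η‖²`.
  have huniq : ∀ η ζ, (η, ζ) ∈ (opComp x.adjoint x).graph → ζ = -η → η = 0 := by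
    rintro η _ h rfl
    obtain ⟨θ, h1, h2⟩ := mem_graph_opComp.1 h
    have h3 := (mem_graph_adjoint hd).1 h2 _ _ h1
    rw [inner_neg_right, inner_self_eq_norm_sq_to_K, inner_self_eq_norm_sq_to_K] at h3
    have h4 : ‖θ‖ ^ 2 = -‖η‖ ^ 2 := by
      have := congrArg Complex.re h3
      simpa [← Complex.ofReal_pow] using this
    have : ‖η‖ ^ 2 = 0 := le_antisymm (by nlinarith [sq_nonneg ‖θ‖]) (sq_nonneg _)
    simpa using this
  refine ⟨r, fun ξ η => ⟨fun h => h ▸ hr ξ, fun h => ?_⟩⟩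
  have := (opComp x.adjoint x).graph.sub_mem (hr ξ) h
  exact sub_eq_zero.1 (huniq (r ξ - η) _ this (by simp))

theorem inner_eq_of_mem_graph {x : H →ₗ.[ℂ] H} (hd : Dense (x.domain : Set H)) {ξ η : H}
    (h : (η, ξ - η) ∈ (opComp x.adjoint x).graph) :
    ∃ θ, (η, θ) ∈ x.graph ∧ inner ℂ η ξ = ((‖η‖ ^ 2 + ‖θ‖ ^ 2 : ℝ) : ℂ) := by
  obtain ⟨θ, h1, h2⟩ := mem_graph_opComp.1 h
  refine ⟨θ, h1, ?_⟩
  have h3 := (mem_graph_adjoint hd).1 h2 _ _ h1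
  rw [inner_sub_right, inner_self_eq_norm_sq_to_K, inner_self_eq_norm_sq_to_K,
    eq_sub_iff_add_eq'] at h3
  rw [← h3]
  simp

variable {M : VonNeumannAlgebra H} {τ : M.toStarSubalgebra →ₗ[ℂ] ℂ}

/-- The commutant is star-closed, so `a` can be moved across the inner product as `star a`. -/
theorem mem_graph_adjoint_of_mem_commutant {x : H →ₗ.[ℂ] H} (hx : IsAffiliated M x)
    (hd : Dense (x.domain : Set H)) {a : H →L[ℂ] H} (ha : a ∈ M.commutant) {ξ η : H}
    (h : (ξ, η) ∈ x.adjoint.graph) : (a ξ, a η) ∈ x.adjoint.graph := by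
  rw [mem_graph_adjoint hd] at h ⊢
  intro u v huv
  have := h _ _ (hx.mem_graph (star_mem ha) huv)
  rwa [ContinuousLinearMap.star_eq_adjoint, ContinuousLinearMap.adjoint_inner_left,
    ContinuousLinearMap.adjoint_inner_left] at this

/-- Chebyshev inequality: if `|w| ≥ K` on the projection `p`, then `φ(K) τ(p) ≤ τ(φ(|w|))`. -/
theorem mul_trace_le_one (hM : IsCommutative M) (hτ : IsFaithfulNormalFiniteTrace M τ)
    {φ : ℝ → ℝ} (hφ : IsYoungFunction φ) {w : H →ₗ.[ℂ] H} (hw : w ∈ youngBall M τ φ)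
    {p : M.toStarSubalgebra} (hp : (p : H →L[ℂ] H) ∈ projections M) {K : ℝ} (hK : 0 ≤ K)
    (h : ∀ ξ, ∃ η, ((p : H →L[ℂ] H) ξ, η) ∈ w.graph ∧ K * ‖(p : H →L[ℂ] H) ξ‖ ≤ ‖η‖) :
    φ K * (τ p).re ≤ 1 := by
  have hd := dense_domain hτ hw.1
  obtain ⟨r, hr⟩ := exists_inverse_one_add hw.1.1 hd
  have hr0 : 0 ≤ r := by
    rw [ContinuousLinearMap.nonneg_iff_isPositive, ContinuousLinearMap.isPositive_iff_complex]
    intro ξ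
    obtain ⟨θ, -, hθ⟩ := inner_eq_of_mem_graph hd ((hr ξ _).1 rfl)
    rw [hθ]
    rw [RCLike.re_to_complex, Complex.ofReal_re]
    refine ⟨rfl, ?_⟩
    positivity
  have hcomm : ∀ a ∈ M.commutant, ∀ ξ, r (a ξ) = a (r ξ) := by
    intro a ha ξ
    obtain ⟨θ, h1, h2⟩ := mem_graph_opComp.1 ((hr ξ _).1 rfl)
    rw [hr, ← map_sub]
    exact mem_graph_opComp.2 ⟨_, hw.1.2.1.mem_graph ha h1,
      mem_graph_adjoint_of_mem_commutant hw.1.2.1 hd ha h2⟩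
  have hrM : r ∈ M := by
    rw [← VonNeumannAlgebra.commutant_commutant M, VonNeumannAlgebra.mem_commutant_iff]
    intro a ha
    ext ξ
    exact (hcomm a ha ξ).symm
  have hpp : ∀ ξ, (p : H →L[ℂ] H) ((p : H →L[ℂ] H) ξ) = (p : H →L[ℂ] H) ξ := fun ξ =>
    congrArg (fun b : H →L[ℂ] H => b ξ) hp.2.isIdempotentElem
  -- With `η = r v` and `θ = w η`, `‖η‖² + ‖θ‖² = ⟨η, v⟩ ≤ ‖η‖ ‖v‖`. As `r` commutes with `p`, `η`
  -- stays in the range of `p`, where `‖θ‖ ≥ K ‖η‖`.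
  have hnorm : ‖r * (p : H →L[ℂ] H)‖ ≤ (1 + K ^ 2)⁻¹ := by
    refine ContinuousLinearMap.opNorm_le_bound _ (by positivity) fun ξ => ?_
    set v := (p : H →L[ℂ] H) ξ
    set η := r v with hη
    have hpη : (p : H →L[ℂ] H) η = η := by
      rw [hη, ← hcomm _ (mem_commutant_of_isCommutative hM hp.1), hpp]
    obtain ⟨θ, h1, h2⟩ := inner_eq_of_mem_graph hd ((hr v _).1 rfl)
    obtain ⟨θ', h3, h4⟩ := h η
    rw [hpη] at h3 h4
    obtain rfl := graph_unique h1 h3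
    have h5 : ‖η‖ ^ 2 + ‖θ‖ ^ 2 ≤ ‖η‖ * ‖v‖ := by
      have := norm_inner_le_norm (𝕜 := ℂ) η v
      rw [h2, Complex.norm_real, Real.norm_of_nonneg (by positivity)] at this
      exact this
    have h6 : (K * ‖η‖) ^ 2 ≤ ‖θ‖ ^ 2 := by gcongr
    have hv : ‖v‖ ≤ ‖ξ‖ := by
      have := (p : H →L[ℂ] H).le_opNorm ξ
      refine this.trans (mul_le_of_le_one_left (norm_nonneg _) hp.2.norm_le)
    change ‖η‖ ≤ _
    rw [inv_mul_eq_div, le_div_iff₀ (by positivity)]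
    refine le_trans ?_ hv
    rcases (norm_nonneg η).eq_or_lt with h0 | h0
    · rw [← h0, zero_mul]; exact norm_nonneg _
    · refine le_of_mul_le_mul_left ?_ h0
      nlinarith
  set r' : M.toStarSubalgebra := ⟨r, hrM⟩
  -- A truncation level above `φ K` does not affect the comparison with `φ K • p`.
  obtain ⟨N, hN⟩ := exists_nat_ge (φ K)
  obtain ⟨g, hg, hgχ⟩ := exists_cfc_eq (r := r') hM hr0 (hφ.continuousOn_truncated N)
  have hle := (le_iSup (fun n : ℕ => posTrace M τ (absCalculus (fun t => min (φ t) n) n w)) N).trans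
    hw.2
  rw [absCalculus, onePlusInv_eq_of_forall hr] at hle
  change posTrace M τ (cfc _ (r' : H →L[ℂ] H)) ≤ 1 at hle
  rw [← hg, posTrace_of_mem, ENNReal.ofReal_le_one] at hle
  refine le_trans ?_ hle
  have hmono : (((φ K : ℂ) • p : M.toStarSubalgebra) : H →L[ℂ] H) ≤ g := by
    rw [← sub_nonneg]
    refine nonneg_of_forall_character hM (a := g - (φ K : ℂ) • p) fun χ => ?_
    obtain ⟨hr1, hr2⟩ := character_nonneg (a := r') hr0 χ
    have hχp := character_projection hp χ
    rw [map_sub, map_smul, hgχ, smul_eq_mul]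
    rcases hχp with h0 | h1
    · rw [h0, mul_zero, sub_zero, Complex.ofReal_re]
      refine ⟨?_, Complex.ofReal_im _⟩
      split_ifs
      · positivity
      · exact le_min (hφ.nonneg (Real.sqrt_nonneg _)) (Nat.cast_nonneg _)
    · rw [h1, mul_one, ← Complex.ofReal_sub, Complex.ofReal_re]
      refine ⟨sub_nonneg.2 ?_, Complex.ofReal_im _⟩
      split_ifs with hz
      · exact hN
      · refine le_min (hφ.monotoneOn hK (Real.sqrt_nonneg _) ?_) hN
        have hpos : 0 < (χ r').re := lt_of_le_of_ne hr1 (Ne.symm hz)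
        -- Where `χ p = 1`, the norm bound on `r p` bounds `χ r`; inverting, `√((χ r)⁻¹ - 1) ≥ K`.
        have h2 : (χ r').re ≤ (1 + K ^ 2)⁻¹ := by
          have h3 := (norm_character_le χ (r' * p)).trans hnorm
          rw [map_mul, h1, mul_one] at h3
          exact (Complex.re_le_norm _).trans h3
        have h3 := inv_anti₀ hpos h2
        rw [inv_inv] at h3
        exact Real.le_sqrt_of_sq_le (by linarith)
  have := hτ.mono hmono
  rwa [map_smul, smul_eq_mul, Complex.re_ofReal_mul] at this

end LowerBound

/-! ### Additive derivations on `M`, the doubling trick, orthogonal projections. -/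

section Derivations

variable {H : Type*} [NormedAddCommGroup H] [InnerProductSpace ℂ H] [CompleteSpace H]
  {M : VonNeumannAlgebra H} {τ : M.toStarSubalgebra →ₗ[ℂ] ℂ}

/-- An additive derivation from `M` into the `τ`-measurable operators. -/
structure IsMeasurableDerivation (M : VonNeumannAlgebra H) (τ : M.toStarSubalgebra →ₗ[ℂ] ℂ)
    (d : M.toStarSubalgebra → H →ₗ.[ℂ] H) : Prop where
  mem : ∀ a, d a ∈ measurableOps M τ
  map_add : ∀ a b, d (a + b) = strongAdd (d a) (d b)
  leibniz : ∀ a b : M.toStarSubalgebra, d (a * b) =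
    strongAdd (strongMul (d a) (ofBounded (b : H →L[ℂ] H)))
      (strongMul (ofBounded (a : H →L[ℂ] H)) (d b))

namespace IsMeasurableDerivation

variable {d : M.toStarSubalgebra → H →ₗ.[ℂ] H}

/-- By Leibniz and commutativity `d e = 2 e (d e)`. Multiplying by `e` gives `e (d e) = 2 e (d e)`,
so `e (d e) = 0` and then `d e = 0`. -/
theorem map_projection (hd : IsMeasurableDerivation M τ d) (hM : IsCommutative M)
    (hτ : IsFaithfulNormalFiniteTrace M τ) {e : M.toStarSubalgebra}
    (he : (e : H →L[ℂ] H) ∈ projections M) : d e = 0 := by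
  refine eq_zero_of_forall_mem_graph hτ (hd.mem e) fun ξ η h => ?_
  have hee : e * e = e := Subtype.ext he.2.isIdempotentElem
  have h1 := hd.leibniz e e
  rw [hee] at h1
  have h2 := mem_graph_strongMul (mem_graph_ofBounded.2 rfl) (mem_graph_of_mem hM (hd.mem e) e.2 h)
  have h3 := mem_graph_strongMul h (mem_graph_ofBounded (a := (e : H →L[ℂ] H)).2 rfl)
  have h4 := mem_graph_strongAdd h2 h3
  rw [← h1] at h4
  have h5 := graph_unique h h4
  have h6 := congrArg (e : H →L[ℂ] H) h5
  rw [_root_.map_add, show (e : H →L[ℂ] H) ((e : H →L[ℂ] H) η) = (e : H →L[ℂ] H) η from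
    congrArg (fun b : H →L[ℂ] H => b η) he.2.isIdempotentElem] at h6
  rw [h5, left_eq_add.1 h6, add_zero]

theorem map_zero (hd : IsMeasurableDerivation M τ d) (hM : IsCommutative M)
    (hτ : IsFaithfulNormalFiniteTrace M τ) : d 0 = 0 :=
  hd.map_projection hM hτ ⟨zero_mem _, IsStarProjection.zero _⟩

/-- Locality: the term containing `d e` vanishes. -/
theorem map_mul_projection (hd : IsMeasurableDerivation M τ d) (hM : IsCommutative M)
    (hτ : IsFaithfulNormalFiniteTrace M τ) (a : M.toStarSubalgebra) {e : M.toStarSubalgebra}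
    (he : (e : H →L[ℂ] H) ∈ projections M) :
    d (a * e) = opComp (d a) (ofBounded (e : H →L[ℂ] H)) := by
  rw [hd.leibniz, hd.map_projection hM hτ he, strongMul_zero (isClosed_ofBounded _),
    strongMul_ofBounded (hd.mem a).1, strongAdd_zero (isClosed_opComp_ofBounded (hd.mem a).1 _)]

theorem map_add_of_left_eq_zero (hd : IsMeasurableDerivation M τ d) {a : M.toStarSubalgebra}
    (ha : d a = 0) (b : M.toStarSubalgebra) : d (a + b) = d b := by
  rw [hd.map_add, ha, zero_strongAdd (hd.mem b).1]

theorem map_two_smul (hd : IsMeasurableDerivation M τ d) (a : M.toStarSubalgebra) :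
    d ((2 : ℂ) • a) = (2 : ℂ) • d a := by
  rw [two_smul, hd.map_add, strongAdd_self (hd.mem a).1]

theorem map_two_pow_smul (hd : IsMeasurableDerivation M τ d) (n : ℕ) (a : M.toStarSubalgebra) :
    d ((2 ^ n : ℂ) • a) = (2 ^ n : ℂ) • d a := by
  induction n with
  | zero => simp
  | succ n ih => rw [pow_succ', mul_smul, hd.map_two_smul, ih, mul_smul]

/-- The doubling map `t ↦ 2 t mod 1` of the unit interval, applied to an operator `0 ≤ a ≤ 1`,
doubles the value of a derivation. -/
theorem exists_map_eq_two_smul (hd : IsMeasurableDerivation M τ d) (hM : IsCommutative M)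
    (hτ : IsFaithfulNormalFiniteTrace M τ) {a : M.toStarSubalgebra}
    (ha : ∀ χ : M.toStarSubalgebra →⋆ₐ[ℂ] ℂ, ∃ t : ℝ, 0 ≤ t ∧ t ≤ 1 ∧ χ a = t) :
    ∃ b : M.toStarSubalgebra,
      (∀ χ : M.toStarSubalgebra →⋆ₐ[ℂ] ℂ, ∃ t : ℝ, 0 ≤ t ∧ t ≤ 1 ∧ χ b = t) ∧
      d b = (2 : ℂ) • d a := by
  obtain ⟨c, hc⟩ := exists_forall_character_eq hM a
    (g := fun z => ((max (z.re - 1 / 2) 0 : ℝ) : ℂ)) (by fun_prop)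
  obtain ⟨c', hc'⟩ := exists_forall_character_eq hM a
    (g := fun z => ((max (1 / 2 - z.re) 0 : ℝ) : ℂ)) (by fun_prop)
  obtain ⟨e, he, hec, hmin⟩ := exists_support_projection c
  have hc'c : c' * c = 0 := by
    refine eq_of_forall_character hM fun χ => ?_
    rw [map_mul, hc, hc', ← Complex.ofReal_mul, _root_.map_zero, Complex.ofReal_eq_zero]
    rcases le_total (χ a).re (1 / 2) with h | h
    · rw [max_eq_right (by linarith : (χ a).re - 1 / 2 ≤ 0), mul_zero]
    · rw [max_eq_right (by linarith : 1 / 2 - (χ a).re ≤ 0), zero_mul]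
  have hc'e := hmin c' hc'c
  -- If `χ e = 0` then `χ c = 0`, so `t ≤ 1/2`; if `χ e = 1` then `χ c' = 0`, so `t ≥ 1/2`. Either
  -- value of `χ e` is acceptable at `t = 1/2`.
  refine ⟨(2 : ℂ) • a - e, fun χ => ?_, ?_⟩
  · obtain ⟨t, ht0, ht1, ht⟩ := ha χ
    have h1 := congrArg χ hec
    have h2 := congrArg χ hc'e
    have h3 := character_projection he χ
    rw [map_mul, hc, ht, Complex.ofReal_re] at h1
    rw [map_mul, hc', ht, Complex.ofReal_re, _root_.map_zero] at h2
    rw [map_sub, map_smul, ht, smul_eq_mul]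
    rcases h3 with h3 | h3
    · rw [h3, zero_mul, eq_comm, Complex.ofReal_eq_zero] at h1
      have := max_eq_right_iff.1 h1
      exact ⟨2 * t, by linarith, by linarith, by rw [h3]; push_cast; ring⟩
    · rw [h3, mul_one, Complex.ofReal_eq_zero] at h2
      have := max_eq_right_iff.1 h2
      exact ⟨2 * t - 1, by linarith, by linarith, by rw [h3]; push_cast; ring⟩
  · rw [← hd.map_two_smul, ← hd.map_add_of_left_eq_zero (hd.map_projection hM hτ he),
      add_sub_cancel]

theorem exists_map_eq_two_pow_smul (hd : IsMeasurableDerivation M τ d) (hM : IsCommutative M)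
    (hτ : IsFaithfulNormalFiniteTrace M τ) {a : M.toStarSubalgebra}
    (ha : ∀ χ : M.toStarSubalgebra →⋆ₐ[ℂ] ℂ, ∃ t : ℝ, 0 ≤ t ∧ t ≤ 1 ∧ χ a = t) (n : ℕ) :
    ∃ b : M.toStarSubalgebra,
      (∀ χ : M.toStarSubalgebra →⋆ₐ[ℂ] ℂ, ∃ t : ℝ, 0 ≤ t ∧ t ≤ 1 ∧ χ b = t) ∧
      d b = (2 ^ n : ℂ) • d a := by
  induction n with
  | zero => exact ⟨a, ha, by simp⟩
  | succ n ih =>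
    obtain ⟨b, hb, hdb⟩ := ih
    obtain ⟨c, hc, hdc⟩ := hd.exists_map_eq_two_smul hM hτ hb
    exact ⟨c, hc, by rw [hdc, hdb, pow_succ', mul_smul]⟩

end IsMeasurableDerivation

theorem norm_le_one_of_forall_character (hM : IsCommutative M) {a : M.toStarSubalgebra}
    (ha : ∀ χ : M.toStarSubalgebra →⋆ₐ[ℂ] ℂ, ∃ t : ℝ, 0 ≤ t ∧ t ≤ 1 ∧ χ a = t) :
    ‖(a : H →L[ℂ] H)‖ ≤ 1 := by
  have h0 : (0 : H →L[ℂ] H) ≤ a := nonneg_of_forall_character hM fun χ => by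
    obtain ⟨t, h0, -, ht⟩ := ha χ
    rw [ht]
    exact ⟨h0, Complex.ofReal_im _⟩
  have h1 : (a : H →L[ℂ] H) ≤ 1 := by
    rw [← sub_nonneg]
    refine nonneg_of_forall_character hM (a := 1 - a) fun χ => ?_
    obtain ⟨t, -, h1, ht⟩ := ha χ
    rw [map_sub, map_one, ht, ← Complex.ofReal_one, ← Complex.ofReal_sub]
    exact ⟨sub_nonneg.2 h1, Complex.ofReal_im _⟩
  exact (CStarAlgebra.norm_le_one_iff_of_nonneg _ h0).2 h1

/-- Below a nonzero projection of an atomless commutative von Neumann algebra there is a sequence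
of mutually orthogonal nonzero projections. -/
theorem exists_orthogonal_projections (hM : IsCommutative M) (hP : HasContinuousProjections M)
    {e : M.toStarSubalgebra} (he : (e : H →L[ℂ] H) ∈ projections M) (he0 : e ≠ 0) :
    ∃ q : ℕ → M.toStarSubalgebra, (∀ n, (q n : H →L[ℂ] H) ∈ projections M) ∧ (∀ n, q n ≠ 0) ∧
      (∀ n, e * q n = q n) ∧ ∀ m n, m ≠ n → q m * q n = 0 := by
  let S := {s : M.toStarSubalgebra // (s : H →L[ℂ] H) ∈ projections M ∧ s ≠ 0}
  have step : ∀ s : S, ∃ t : S, s.1 * t.1 = t.1 ∧ t.1 ≠ s.1 := by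
    rintro ⟨s, hs, hs0⟩
    obtain ⟨t, ht, ht0, hle, hne⟩ := hP s hs fun h => hs0 (Subtype.ext h)
    refine ⟨⟨⟨t, ht.1⟩, ht, fun h => ht0 (congrArg Subtype.val h)⟩, ?_, fun h =>
      hne (congrArg Subtype.val h)⟩
    exact Subtype.ext ((ht.2.le_iff_mul_eq_right hs.2).1 hle)
  choose f hf hf' using step
  -- A strictly decreasing chain of nonzero projections; its consecutive differences are the
  -- required orthogonal ones.
  let s : ℕ → S := fun n => f^[n] ⟨e, he, he0⟩
  have hs : ∀ n, s (n + 1) = f (s n) := fun n => Function.iterate_succ_apply' f n _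
  have hidem : ∀ n, (s n).1 * (s n).1 = (s n).1 := fun n =>
    Subtype.ext (s n).2.1.2.isIdempotentElem
  have hmul : ∀ m n, m ≤ n → (s m).1 * (s n).1 = (s n).1 := by
    intro m n hmn
    induction n, hmn using Nat.le_induction with
    | base => exact hidem m
    | succ n _ ih =>
      have h1 : (s n).1 * (s (n + 1)).1 = (s (n + 1)).1 := by rw [hs]; exact hf _
      rw [← h1, ← mul_assoc, ih]
  have hcomm := mul_comm_of_isCommutative hM
  have horth : ∀ m n, m < n → ((s m).1 - (s (m + 1)).1) * ((s n).1 - (s (n + 1)).1) = 0 := by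
    intro m n hmn
    rw [sub_mul, mul_sub, mul_sub, hmul m n hmn.le, hmul m (n + 1) (by omega),
      hmul (m + 1) n hmn, hmul (m + 1) (n + 1) (by omega), sub_self]
  refine ⟨fun n => (s n).1 - (s (n + 1)).1,
    fun n => ⟨SetLike.coe_mem ((s n).1 - (s (n + 1)).1), ?_⟩, fun n h => ?_, fun n => ?_, fun m n hmn => ?_⟩
  · refine ((s (n + 1)).2.1.2.le_iff_sub (s n).2.1.2).1 ?_
    refine ((s (n + 1)).2.1.2.le_iff_mul_eq_right (s n).2.1.2).2 ?_
    exact congrArg Subtype.val (hmul n (n + 1) (by omega))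
  · refine hf' (s n) ?_
    rw [← hs, sub_eq_zero.1 h]
  · have h0 : ∀ n, e * (s n).1 = (s n).1 := fun n => hmul 0 n (by omega)
    rw [mul_sub, h0, h0]
  · rcases lt_or_gt_of_ne hmn with h | h
    · exact horth m n h
    · rw [hcomm]
      exact horth n m h

end Derivations

/-! ### Vanishing of the derivation on `M` and then everywhere. -/

section Vanishing

variable {H : Type*} [NormedAddCommGroup H] [InnerProductSpace ℂ H] [CompleteSpace H]
  {M : VonNeumannAlgebra H} {τ : M.toStarSubalgebra →ₗ[ℂ] ℂ}

theorem trace_projection_pos (hτ : IsFaithfulNormalFiniteTrace M τ) {p : M.toStarSubalgebra}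
    (hp : (p : H →L[ℂ] H) ∈ projections M) (hp0 : p ≠ 0) : 0 < (τ p).re := by
  obtain ⟨h1, h2⟩ := hτ.nonneg p (projections_nonneg hp)
  refine lt_of_le_of_ne h1 fun h => hp0 (hτ.faithful p (projections_nonneg hp) ?_)
  exact Complex.ext h.symm h2

/-- Some nonzero projection bounds a nonzero element from below. -/
theorem exists_projection_mul_norm_le (hM : IsCommutative M) {b : M.toStarSubalgebra}
    (hb : b ≠ 0) :
    ∃ e : M.toStarSubalgebra, (e : H →L[ℂ] H) ∈ projections M ∧ e ≠ 0 ∧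
      (∀ p : M.toStarSubalgebra, b * p = b → p * e = e) ∧
      ∃ δ : ℝ, 0 < δ ∧ ∀ q : M.toStarSubalgebra, e * q = q →
        ∀ ξ, δ * ‖(q : H →L[ℂ] H) ξ‖ ≤ ‖(b : H →L[ℂ] H) ((q : H →L[ℂ] H) ξ)‖ := by
  obtain ⟨χ₀, hχ₀⟩ : ∃ χ : M.toStarSubalgebra →⋆ₐ[ℂ] ℂ, χ b ≠ 0 := by
    by_contra! h
    exact hb (eq_of_forall_character hM fun χ => by rw [h, map_zero])
  -- Half the value leaves `χ₀ c > 0`, so the support `e` of `(|b| - δ)⁺` is nonzero.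
  set δ : ℝ := ‖χ₀ b‖ / 2 with hδ
  have hδ0 : 0 < δ := by positivity
  obtain ⟨c, hc⟩ := exists_forall_character_eq hM b
    (g := fun z => ((max (‖z‖ - δ) 0 : ℝ) : ℂ)) (by fun_prop)
  obtain ⟨c', hc'⟩ := exists_forall_character_eq hM b
    (g := fun z => ((max (δ - ‖z‖) 0 : ℝ) : ℂ)) (by fun_prop)
  obtain ⟨e, he, hec, hmin⟩ := exists_support_projection c
  have hc'c : c' * c = 0 := by
    refine eq_of_forall_character hM fun χ => ?_
    rw [map_mul, hc, hc', ← Complex.ofReal_mul, map_zero, Complex.ofReal_eq_zero]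
    rcases le_total ‖χ b‖ δ with h | h
    · rw [max_eq_right (by linarith : ‖χ b‖ - δ ≤ 0), mul_zero]
    · rw [max_eq_right (by linarith : δ - ‖χ b‖ ≤ 0), zero_mul]
  have hc'e := hmin c' hc'c
  refine ⟨e, he, ?_, ?_, δ, hδ0, ?_⟩
  · rintro rfl
    rw [zero_mul] at hec
    have := hc χ₀
    rw [← hec, map_zero, eq_comm, Complex.ofReal_eq_zero] at this
    have := max_eq_right_iff.1 this
    linarith
  · intro p hp
    -- A character either kills `b`, hence `c`, or satisfies `χ p = 1`.
    have : (1 - p) * c = 0 := by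
      refine eq_of_forall_character hM fun χ => ?_
      have h1 := congrArg χ hp
      rw [map_mul] at h1
      rw [map_mul, map_sub, map_one, map_zero, hc, mul_eq_zero]
      by_cases h0 : χ b = 0
      · right
        rw [h0, norm_zero, max_eq_right (by linarith), Complex.ofReal_zero]
      · left
        rw [sub_eq_zero, mul_left_cancel₀ h0 (h1.trans (mul_one _).symm)]
    have := hmin _ this
    rw [sub_mul, one_mul, sub_eq_zero] at this
    exact this.symm
  · intro q hq ξ
    -- The lower bound in operator form, `(b e)* (b e) ≥ δ² e`; evaluating the quadratic form at `v
    -- = e v` yields the norm estimate.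
    have h0 : (0 : H →L[ℂ] H) ≤
        ((star (b * e) * (b * e) - ((δ ^ 2 : ℝ) : ℂ) • e : M.toStarSubalgebra) :
          H →L[ℂ] H) := by
      refine nonneg_of_forall_character hM fun χ => ?_
      have h3 := character_projection he χ
      have h2 := congrArg χ hc'e
      rw [map_mul, hc', map_zero] at h2
      rw [map_sub, map_smul, map_mul, map_star, map_mul]
      rcases h3 with h3 | h3
      · simp [h3]
      · rw [h3, mul_one, Complex.ofReal_eq_zero] at h2
        have h4 := max_eq_right_iff.1 h2
        rw [h3, mul_one, Complex.star_def, ← Complex.normSq_eq_conj_mul_self,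
          Complex.normSq_eq_norm_sq, smul_eq_mul, mul_one, ← Complex.ofReal_sub,
          Complex.ofReal_re]
        refine ⟨sub_nonneg.2 ?_, Complex.ofReal_im _⟩
        exact pow_le_pow_left₀ hδ0.le (by linarith) 2
    set v := (q : H →L[ℂ] H) ξ
    have hev : (e : H →L[ℂ] H) v = v :=
      congrArg (fun b : M.toStarSubalgebra => (b : H →L[ℂ] H) ξ) hq
    have h1 := ((ContinuousLinearMap.nonneg_iff_isPositive _).1 h0).re_inner_nonneg_left v
    have h2 : ((star (b * e) * (b * e) - ((δ ^ 2 : ℝ) : ℂ) • e : M.toStarSubalgebra) :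
        H →L[ℂ] H) v = star ((b : H →L[ℂ] H) * (e : H →L[ℂ] H)) ((b : H →L[ℂ] H) v) -
          ((δ ^ 2 : ℝ) : ℂ) • v := by
      change star ((b : H →L[ℂ] H) * (e : H →L[ℂ] H))
        ((b : H →L[ℂ] H) ((e : H →L[ℂ] H) v)) - ((δ ^ 2 : ℝ) : ℂ) • (e : H →L[ℂ] H) v = _
      rw [hev]
    rw [h2, inner_sub_left, ContinuousLinearMap.star_eq_adjoint,
      ContinuousLinearMap.adjoint_inner_left] at h1
    rw [show ((b : H →L[ℂ] H) * (e : H →L[ℂ] H)) v = (b : H →L[ℂ] H) v from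
      congrArg (b : H →L[ℂ] H) hev, inner_smul_left, Complex.conj_ofReal,
      inner_self_eq_norm_sq_to_K, inner_self_eq_norm_sq_to_K] at h1
    have h5 : 0 ≤ ‖(b : H →L[ℂ] H) v‖ ^ 2 - δ ^ 2 * ‖v‖ ^ 2 := by
      have e1 : ((‖(b : H →L[ℂ] H) v‖ : ℂ) ^ 2 - ((δ ^ 2 : ℝ) : ℂ) * (‖v‖ : ℂ) ^ 2) =
          ((‖(b : H →L[ℂ] H) v‖ ^ 2 - δ ^ 2 * ‖v‖ ^ 2 : ℝ) : ℂ) := by push_cast; ring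
      have h1 : 0 ≤ (((‖(b : H →L[ℂ] H) v‖ : ℂ) ^ 2 -
        ((δ ^ 2 : ℝ) : ℂ) * (‖v‖ : ℂ) ^ 2)).re := h1
      rwa [e1, Complex.ofReal_re] at h1
    refine le_of_sq_le_sq ?_ (norm_nonneg _)
    rw [mul_pow]
    linarith

/-- Given mutually orthogonal projections `q n` and uniformly bounded `a n`, there is one element
whose components along `q n` are the `a n`, up to powers of two. -/
theorem exists_two_pow_smul_mul_eq (hM : IsCommutative M) {q a : ℕ → M.toStarSubalgebra}
    (hq : ∀ n, (q n : H →L[ℂ] H) ∈ projections M) (hqq : ∀ m n, m ≠ n → q m * q n = 0)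
    (ha : ∀ n, ‖(a n : H →L[ℂ] H)‖ ≤ 1) :
    ∃ y : M.toStarSubalgebra, ∀ n, ((2 : ℂ) ^ n) • (y * q n) = a n * q n := by
  have := isClosed_toStarSubalgebra M
  have hcomm := mul_comm_of_isCommutative hM
  -- The damping makes the series norm convergent, and being a power of two it can be pulled through
  -- an additive `d`.
  let f : ℕ → M.toStarSubalgebra := fun n => ((2 : ℂ) ^ n)⁻¹ • (q n * a n)
  have hf : Summable f := by
    refine Summable.of_norm_bounded (g := fun n => ((1 / 2 : ℝ)) ^ n)
      (summable_geometric_of_lt_one (by norm_num) (by norm_num)) fun n => ?_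
    change ‖((2 : ℂ) ^ n)⁻¹ • ((q n : H →L[ℂ] H) * (a n : H →L[ℂ] H))‖ ≤ _
    rw [norm_smul, norm_inv, norm_pow, Complex.norm_ofNat, one_div, inv_pow]
    refine mul_le_of_le_one_right (by positivity) ((norm_mul_le _ _).trans ?_)
    exact mul_le_one₀ (hq n).2.norm_le (norm_nonneg _) (ha n)
  refine ⟨∑' n, f n, fun n => ?_⟩
  have h1 : q n * ∑' m, f m = ((2 : ℂ) ^ n)⁻¹ • (q n * a n) := by
    rw [← hf.tsum_mul_left, tsum_eq_single n]
    · rw [mul_smul_comm, ← mul_assoc, show q n * q n = q n from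
        Subtype.ext (hq n).2.isIdempotentElem]
    · intro m hm
      rw [mul_smul_comm, ← mul_assoc, hqq n m hm.symm, zero_mul, smul_zero]
  rw [hcomm, h1, smul_inv_smul₀ (pow_ne_zero _ two_ne_zero), hcomm]

namespace IsMeasurableDerivation

variable {d : M.toStarSubalgebra → H →ₗ.[ℂ] H}

/-- If the values of a derivation are `φ`-integrable, it vanishes on every `0 ≤ a ≤ 1`: otherwise,
some element has a derivative that is too large on a sequence of orthogonal projections. -/
theorem eq_zero_of_forall_character (hd : IsMeasurableDerivation M τ d) (hM : IsCommutative M)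
    (hτ : IsFaithfulNormalFiniteTrace M τ) (hP : HasContinuousProjections M) {φ : ℝ → ℝ}
    (hφ : IsYoungFunction φ) (hdφ : ∀ a, d a ∈ orliczSpace M τ φ) {a : M.toStarSubalgebra}
    (ha : ∀ χ : M.toStarSubalgebra →⋆ₐ[ℂ] ℂ, ∃ t : ℝ, 0 ≤ t ∧ t ≤ 1 ∧ χ a = t) : d a = 0 := by
  by_contra hne
  obtain ⟨p, hp, b, hbp, hb0⟩ : ∃ p : M.toStarSubalgebra, (p : H →L[ℂ] H) ∈ projections M ∧
      ∃ b : M.toStarSubalgebra, (∀ ξ, ((p : H →L[ℂ] H) ξ, (b : H →L[ℂ] H) ξ) ∈ (d a).graph) ∧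
        b ≠ 0 := by
    by_contra! h
    refine hne (eq_zero_of_forall_projection hτ (hd.mem a) fun ε hε => ?_)
    obtain ⟨p, hp, h1, h2⟩ := (hd.mem a).2.2 ε hε
    obtain ⟨b, hb, hbp⟩ := exists_mem_opComp_eq_ofBounded (hd.mem a) hp.1 h1
    have hg : ∀ ξ, (p ξ, b ξ) ∈ (d a).graph := fun ξ => by
      have : (ξ, b ξ) ∈ (opComp (d a) (ofBounded p)).graph := by
        rw [hbp, mem_graph_ofBounded]
      simpa only [mem_graph_opComp, mem_graph_ofBounded, exists_eq_left'] using this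
    refine ⟨p, hp, fun ξ => ?_, h2⟩
    have h3 := h ⟨p, hp.1⟩ hp ⟨b, hb⟩ hg
    have h4 := hg ξ
    rwa [show b ξ = 0 from congrArg (fun b : M.toStarSubalgebra => (b : H →L[ℂ] H) ξ) h3] at h4
  have hpp : ∀ ξ, (p : H →L[ℂ] H) ((p : H →L[ℂ] H) ξ) = (p : H →L[ℂ] H) ξ := fun ξ =>
    congrArg (fun b : H →L[ℂ] H => b ξ) hp.2.isIdempotentElem
  have hbpb : b * p = b := by
    ext ξ
    have := hbp ((p : H →L[ℂ] H) ξ)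
    rw [hpp] at this
    exact graph_unique this (hbp ξ)
  obtain ⟨e, he, he0, hpe, δ, hδ, hlow⟩ := exists_projection_mul_norm_le hM hb0
  obtain ⟨q, hq, hq0, heq, hqq⟩ := exists_orthogonal_projections hM hP he he0
  -- The factor `2 ^ n` compensates the damping in `y`; `n + 1` dominates the scale `n` in `n K_φ`
  -- and avoids division by zero at `n = 0`.
  have hk : ∀ n : ℕ, ∃ k : ℕ,
      1 < φ ((2 ^ k : ℝ) * (δ / (2 ^ n * (n + 1)))) * (τ (q n)).re := by
    intro n
    have h1 : Tendsto (fun k : ℕ => (2 ^ k : ℝ) * (δ / (2 ^ n * (n + 1)))) atTop atTop :=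
      (tendsto_pow_atTop_atTop_of_one_lt one_lt_two).atTop_mul_const (by positivity)
    have h2 := (hφ.tendsto_atTop.comp h1).atTop_mul_const (trace_projection_pos hτ (hq n) (hq0 n))
    exact (h2.eventually_gt_atTop 1).exists
  choose k hk using hk
  choose A hA hdA using fun n => hd.exists_map_eq_two_pow_smul hM hτ ha (k n)
  obtain ⟨y, hy⟩ := exists_two_pow_smul_mul_eq hM hq hqq
    fun n => norm_le_one_of_forall_character hM (hA n)
  -- The scale `n` of `d y = n w` also selects the projection `q n` on which `w` is too large.
  obtain ⟨n, hn, w, hw, hdy⟩ := hdφ y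
  refine absurd (hk n) (not_lt.2 (mul_trace_le_one hM hτ hφ hw (hq n) (by positivity) fun ξ => ?_))
  set v := (q n : H →L[ℂ] H) ξ with hv
  have hpv : (p : H →L[ℂ] H) v = v := by
    have h1 : p * q n = q n := by rw [← heq n, ← mul_assoc, hpe p hbpb]
    exact congrArg (fun b : M.toStarSubalgebra => (b : H →L[ℂ] H) ξ) h1
  have h1 := hbp v
  rw [hpv] at h1
  -- Since `A n * q n = 2^n • (y * q n)`, its derivative at `ξ` has two expressions, giving `2^n n w
  -- v = 2^(k n) b v`.
  have h2 : (ξ, (2 ^ k n : ℂ) • (b : H →L[ℂ] H) v) ∈ (d (A n * q n)).graph := by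
    rw [hd.map_mul_projection hM hτ _ (hq n), mem_graph_opComp, hdA]
    exact ⟨v, mem_graph_ofBounded.2 rfl, mem_graph_smul.2 ⟨_, h1, rfl⟩⟩
  rw [← hy, hd.map_two_pow_smul, mem_graph_smul, hd.map_mul_projection hM hτ _ (hq n), hdy] at h2
  obtain ⟨ζ, h3, h4⟩ := h2
  rw [mem_graph_opComp] at h3
  obtain ⟨v', h5, h6⟩ := h3
  obtain rfl : v = v' := mem_graph_ofBounded.1 h5
  obtain ⟨ω, h7, rfl⟩ := mem_graph_smul.1 h6
  refine ⟨ω, h7, ?_⟩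
  have h8 := congrArg norm h4
  rw [norm_smul, norm_smul, norm_smul, norm_pow, norm_pow, Complex.norm_ofNat,
    Complex.norm_natCast] at h8
  have h9 := hlow (q n) (heq n) ξ
  rw [← hv] at h9
  have hpos : (0 : ℝ) < 2 ^ n * (n + 1) := by positivity
  have h10 : (2 ^ k n : ℝ) * (δ * ‖v‖) ≤ 2 ^ n * (n + 1) * ‖ω‖ := by
    calc (2 ^ k n : ℝ) * (δ * ‖v‖) ≤ 2 ^ k n * ‖(b : H →L[ℂ] H) v‖ := by gcongr
      _ = 2 ^ n * (n * ‖ω‖) := h8.symm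
      _ ≤ 2 ^ n * (n + 1) * ‖ω‖ := by
        rw [mul_assoc]
        gcongr
        linarith
  rw [show (2 ^ k n : ℝ) * (δ / (2 ^ n * (n + 1))) * ‖v‖ =
    (2 ^ k n : ℝ) * (δ * ‖v‖) / (2 ^ n * (n + 1)) by ring, div_le_iff₀ hpos]
  linarith

/-- Move the spectrum into `[0, 1]` by `a ↦ 2^(-n-1) a + 1/2`. The dyadic coefficients allow the
change to be undone using additivity and `d 1 = 0` alone. -/
theorem eq_zero_of_isSelfAdjoint (hd : IsMeasurableDerivation M τ d) (hM : IsCommutative M)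
    (hτ : IsFaithfulNormalFiniteTrace M τ) (hP : HasContinuousProjections M) {φ : ℝ → ℝ}
    (hφ : IsYoungFunction φ) (hdφ : ∀ a, d a ∈ orliczSpace M τ φ) {a : M.toStarSubalgebra}
    (ha : IsSelfAdjoint a) : d a = 0 := by
  obtain ⟨n, hn⟩ := pow_unbounded_of_one_lt ‖(a : H →L[ℂ] H)‖ (one_lt_two (α := ℝ))
  set s : ℝ := (2 ^ (n + 1))⁻¹ with hs
  have hs2 : (2 ^ (n + 1) : ℂ) * (s : ℂ) = 1 := by
    rw [hs]; push_cast; exact mul_inv_cancel₀ (pow_ne_zero _ two_ne_zero)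
  set c : M.toStarSubalgebra := (s : ℂ) • a + ((1 / 2 : ℝ) : ℂ) • 1 with hc
  have hdc : d c = 0 := by
    refine hd.eq_zero_of_forall_character hM hτ hP hφ hdφ fun χ => ?_
    have him : (χ a).im = 0 := by
      have := congrArg χ ha.star_eq
      rw [map_star] at this
      exact Complex.conj_eq_iff_im.1 this
    have hre : χ a = ((χ a).re : ℂ) := Complex.ext rfl him
    have hle : |(χ a).re| ≤ 2 ^ n :=
      ((Complex.abs_re_le_norm _).trans (norm_character_le χ a)).trans hn.le
    obtain ⟨h1, h2⟩ := abs_le.1 hle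
    have hs3 : s * 2 ^ n = 1 / 2 := by
      rw [hs, pow_succ]; field_simp
    have hs0 : 0 < s := by positivity
    refine ⟨s * (χ a).re + 1 / 2, by nlinarith, by nlinarith, ?_⟩
    rw [hc, _root_.map_add, map_smul, map_smul, map_one, hre]
    push_cast
    simp
  have hone : d 1 = 0 := hd.map_projection hM hτ ⟨one_mem _, IsStarProjection.one _⟩
  have h1 : (2 ^ (n + 1) : ℂ) • c = (2 ^ n : ℂ) • 1 + a := by
    rw [hc, smul_add, smul_smul, smul_smul, hs2, one_smul, add_comm]
    congr 2
    push_cast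
    rw [pow_succ]
    ring
  have h2 : d ((2 ^ n : ℂ) • 1) = 0 := by
    rw [hd.map_two_pow_smul, hone, ← ofBounded_zero, smul_ofBounded, smul_zero]
  rw [← hd.map_add_of_left_eq_zero h2, ← h1, hd.map_two_pow_smul, hdc, ← ofBounded_zero,
    smul_ofBounded, smul_zero]

/-- Complex linearity is not available, but `i² = -1` gives `2 i d(i) = d(-1) = 0`. -/
theorem map_I (hd : IsMeasurableDerivation M τ d) (hM : IsCommutative M)
    (hτ : IsFaithfulNormalFiniteTrace M τ) : d (Complex.I • 1) = 0 := by
  have hone : d 1 = 0 := hd.map_projection hM hτ ⟨one_mem _, IsStarProjection.one _⟩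
  have hneg : d (-1) = 0 := by
    rw [← hd.map_add_of_left_eq_zero hone, add_neg_cancel, hd.map_zero hM hτ]
  set i : M.toStarSubalgebra := Complex.I • 1 with hi
  have hii : i * i = -1 := by
    rw [hi, smul_mul_smul_comm, Complex.I_mul_I, one_mul, neg_one_smul]
  have hiη : ∀ η, (i : H →L[ℂ] H) η = Complex.I • η := fun η => rfl
  refine eq_zero_of_forall_mem_graph hτ (hd.mem i) fun ξ η h => ?_
  have h1 := hd.leibniz i i
  rw [hii, hneg] at h1
  have h2 := mem_graph_strongMul (mem_graph_ofBounded.2 rfl) (mem_graph_of_mem hM (hd.mem i) i.2 h)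
  have h3 := mem_graph_strongMul h (mem_graph_ofBounded (a := (i : H →L[ℂ] H)).2 rfl)
  have h4 := mem_graph_strongAdd h2 h3
  rw [← h1, ← ofBounded_zero, mem_graph_ofBounded, hiη, ← two_smul ℂ, smul_smul] at h4
  exact (smul_eq_zero.1 h4.symm).resolve_left (by simp)

theorem eq_zero (hd : IsMeasurableDerivation M τ d) (hM : IsCommutative M)
    (hτ : IsFaithfulNormalFiniteTrace M τ) (hP : HasContinuousProjections M) {φ : ℝ → ℝ}
    (hφ : IsYoungFunction φ) (hdφ : ∀ a, d a ∈ orliczSpace M τ φ) (a : M.toStarSubalgebra) :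
    d a = 0 := by
  have hsa : ∀ {b : M.toStarSubalgebra}, IsSelfAdjoint b → d b = 0 :=
    fun hb => hd.eq_zero_of_isSelfAdjoint hM hτ hP hφ hdφ hb
  have h1 : a = (realPart a : M.toStarSubalgebra) +
      (Complex.I • 1) * (imaginaryPart a : M.toStarSubalgebra) := by
    rw [smul_one_mul]
    exact (realPart_add_I_smul_imaginaryPart a).symm
  rw [h1, hd.map_add_of_left_eq_zero (hsa (realPart a).2), hd.leibniz, hd.map_I hM hτ,
    hsa (imaginaryPart a).2, zero_strongMul_ofBounded, strongMul_zero (isClosed_ofBounded _),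
    ← ofBounded_zero, ofBounded_add, add_zero]

end IsMeasurableDerivation

/-- An element of `M`, as an element of the generalized Arens algebra. -/
def toArensAlgebra (hM : IsCommutative M) (hτ : IsFaithfulNormalFiniteTrace M τ)
    {Λ : Set (ℝ → ℝ)} (hΛ : IsQuadraticFamily Λ) (a : M.toStarSubalgebra) : arensAlgebra M τ Λ :=
  ⟨ofBounded (a : H →L[ℂ] H), ofBounded_mem_arensAlgebra hM hτ hΛ a⟩

theorem IsAdditiveDerivation.isMeasurableDerivation (hM : IsCommutative M)
    (hτ : IsFaithfulNormalFiniteTrace M τ) {Λ : Set (ℝ → ℝ)} (hΛ : IsQuadraticFamily Λ)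
    {D : arensAlgebra M τ Λ → arensAlgebra M τ Λ}
    (hD : IsAdditiveDerivation (arensAlgebra M τ Λ) D) :
    IsMeasurableDerivation M τ fun a => (D (toArensAlgebra hM hτ hΛ a) : H →ₗ.[ℂ] H) := by
  set ι := toArensAlgebra hM hτ hΛ
  refine ⟨fun a => ?_, fun a b => ?_, fun a b => ?_⟩
  · exact mem_measurableOps_of_mem_arensAlgebra hΛ (D (ι a)).2
  · exact hD.map_add (ι a) (ι b) (ι (a + b))
      (ofBounded_add (a : H →L[ℂ] H) (b : H →L[ℂ] H)).symm
  · exact hD.leibniz (ι a) (ι b) (ι (a * b))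
      (ofBounded_mul (a : H →L[ℂ] H) (b : H →L[ℂ] H)).symm

/-- When `x p = b` is bounded, `D` kills both `p` and `b`, so Leibniz leaves `0 = D(x) p`. Such `p`
have trace arbitrarily close to full, which forces `D x = 0`. -/
theorem IsAdditiveDerivation.eq_zero (hM : IsCommutative M)
    (hτ : IsFaithfulNormalFiniteTrace M τ) (hP : HasContinuousProjections M)
    {Λ : Set (ℝ → ℝ)} (hΛ : IsQuadraticFamily Λ) {D : arensAlgebra M τ Λ → arensAlgebra M τ Λ}
    (hD : IsAdditiveDerivation (arensAlgebra M τ Λ) D) (x : arensAlgebra M τ Λ) :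
    (D x : H →ₗ.[ℂ] H) = 0 := by
  have hmeas : ∀ z : arensAlgebra M τ Λ, (z : H →ₗ.[ℂ] H) ∈ measurableOps M τ := fun z =>
    mem_measurableOps_of_mem_arensAlgebra hΛ z.2
  have hd := hD.isMeasurableDerivation hM hτ hΛ
  obtain ⟨φ, hφ⟩ := hΛ.nonempty
  have h0 : ∀ a : M.toStarSubalgebra, (D (toArensAlgebra hM hτ hΛ a) : H →ₗ.[ℂ] H) = 0 :=
    hd.eq_zero hM hτ hP (hΛ.young φ hφ) fun a => (D (toArensAlgebra hM hτ hΛ a)).2 φ hφ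
  refine eq_zero_of_forall_projection hτ (hmeas _) fun ε hε => ?_
  obtain ⟨p, hp, h1, h2⟩ := (hmeas x).2.2 ε hε
  obtain ⟨b, hb, hbp⟩ := exists_mem_opComp_eq_ofBounded (hmeas x) hp.1 h1
  refine ⟨p, hp, fun ξ => ?_, h2⟩
  have h3 := hD.leibniz x (toArensAlgebra hM hτ hΛ ⟨p, hp.1⟩) (toArensAlgebra hM hτ hΛ ⟨b, hb⟩)
    (hbp.symm.trans (strongMul_ofBounded (hmeas x).1 p).symm)
  rw [h0, h0, strongMul_zero (hmeas x).1] at h3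
  change 0 = strongAdd (strongMul (D x : H →ₗ.[ℂ] H) (ofBounded p)) 0 at h3
  rw [strongMul_ofBounded (hmeas _).1, strongAdd_zero (isClosed_opComp_ofBounded (hmeas _).1 _)]
    at h3
  have h4 : (ξ, (0 : H)) ∈ (opComp (D x : H →ₗ.[ℂ] H) (ofBounded p)).graph := by
    rw [← h3, ← ofBounded_zero, mem_graph_ofBounded]
    rfl
  simpa only [mem_graph_opComp, mem_graph_ofBounded, exists_eq_left'] using h4

end Vanishing

end GenArens

end

theorem corollary3p1 {H : Type*} [NormedAddCommGroup H] [InnerProductSpace ℂ H] [CompleteSpace H]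
    (M : VonNeumannAlgebra H) (hM : GenArens.IsCommutative M)
    (τ : M.toStarSubalgebra →ₗ[ℂ] ℂ) (hτ : GenArens.IsFaithfulNormalFiniteTrace M τ)
    (hP : GenArens.HasContinuousProjections M)
    (Λ : Set (ℝ → ℝ)) (hΛ : GenArens.IsQuadraticFamily Λ)
    (D : GenArens.arensAlgebra M τ Λ → GenArens.arensAlgebra M τ Λ)
    (hD : GenArens.IsAdditiveDerivation (GenArens.arensAlgebra M τ Λ) D)
    (x : GenArens.arensAlgebra M τ Λ) :
    (D x : H →ₗ.[ℂ] H) = 0 := by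
  exact hD.eq_zero hM hτ hP hΛ x
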